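/- Let $S$ be a finite dimensional complex manifold with structure sheaf $\mathcal O$. For $s\in S$ let $\mathcal J(s)\subset\mathcal O$ be the subsheaf of germs vanishing at $s$, and for a sheaf $\mathcal F$ of $\mathcal O$-modules put $\mathcal F^s=\mathcal F_s/(\mathcal J(s)\mathcal F)_s$. A *metric* on $\mathcal F$ is a morphism $p$ of sheaves of sets from $\mathcal F$ to the sheaf of germs of nonnegative continuous functions such that $p(\varphi+\psi)\le p(\varphi)+p(\psi)$, $p(f\varphi)=|f|\,p(\varphi)$ for $f\in\mathcal O_s$ and $\varphi,\psi\in\mathcal F_s$, and $p(\varphi)=0$ if and only if $\varphi=0$. It induces a seminorm $p^s$ on $\mathcal F^s$, by $p^s(v)=p(\varphi)(s)$ for $\varphi\in v$. For $u$ real valued and continuous near $z_0\in\mathbb C$ let $\Lambda u(z_0)=\limsup_{r\to0+}r^{-2}\bigl(\int_0^1u(z_0+re^{2\pi i\tau})\,d\tau-u(z_0)\bigr)$. For $u$ real valued and continuous near $s\in S$ and $\xi\in T^{1,0}_sS$ let $\xi\bar\xi u=\inf_f\Lambda(u\circ f)(0)\in[-\infty,\infty]$, where $f$ runs over the holomorphic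 maps from a neighborhood of $0\in\mathbb C$ to $S$ that send $\partial/\partial z$ at $0$ to $\xi$. The *Griffiths curvature* of $(\mathcal F,p)$ is defined, for $\xi\in T^{1,0}_sS$ and $v\in\mathcal F^s$ with $p^s(v)\ne0$, by $$-K_\xi(v)=2\inf\{\xi\bar\xi\log p(\varphi):\varphi\in v\},\qquad K_\xi(v)\in[-\infty,\infty].$$ Let $(\mathcal F,p)$ and $(\mathcal F',p')$ be sheaves of $\mathcal O$-modules on $S$ with metrics, with Griffiths curvatures $K,K'$. For a homomorphism $\alpha:\mathcal F\to\mathcal F'$ of $\mathcal O$-modules let $$\|\alpha\|(s)=\inf\{a\in[0,\infty):p'(\alpha\varphi)(s)\le a\,p(\varphi)(s)\ \text{for all}\ \varphi\in\mathcal F_s\}\in[0,\infty];$$ $\alpha$ is called a homomorphism $(\mathcal F,p)\to(\mathcal F',p')$ if $\|\alpha\|$ is finite and continuous on $S$. Let $\alpha^s:\mathcal F^s\to\mathcal F'^s$ be the induced maps. **Theorem.** Suppose that $\mathcal F$ is the sheaf of holomorphic sections of a holomorphic Hilbert bundle $E\to S$ with a (positive definite) hermitian metric $h$ of class $C^2$,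 and $p(\varphi)=h(\varphi,\varphi)^{1/2}$; here $h$ is of class $C^2$ if in local trivializations it is given by $\langle P(s)w_1,w_2\rangle$ with $P$ a $C^2$ map into the invertible positive self-adjoint bounded operators on the Hilbert space $W$ that models the fibers. Let $(\mathcal F',p')$ be any sheaf of $\mathcal O$-modules with a metric. If $\alpha:(\mathcal F,p)\to(\mathcal F',p')$ is a homomorphism such that for all $s\in S$ $$K'_\xi(\alpha^sv)\le K_\xi(v)\qquad\text{for all }\xi\in T^{1,0}_sS,\ v\in\mathcal F^s\ \text{with}\ p'^s(\alpha^sv)\ne0,$$ then $\log\|\alpha\|:S\to[-\infty,\infty)$ is plurisubharmonic, that is, it is upper semicontinuous and its composition with any holomorphic map from an open set in $\mathbb C$ to $S$ is subharmonic (the value $-\infty$, even identically, being allowed). -/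

import Mathlib

set_option linter.unusedSectionVars false

open CategoryTheory TopologicalSpace Opposite Topology Bundle
open scoped Manifold ContDiff NNReal ENNReal

universe u v w

noncomputable section

section StructureSheaf

variable (V : Type*) [NormedAddCommGroup V] [NormedSpace ℂ V]
    (S : Type u) [TopologicalSpace S] [ChartedSpace V S]

/-- Holomorphy (smoothness over `ℂ`) as a local predicate on functions `U → ℂ`. -/
def holFunctionPredicate : TopCat.LocalPredicate (X := TopCat.of S) (fun _ => ℂ) where
  pred {U} f := ContMDiff 𝓘(ℂ, V) 𝓘(ℂ, ℂ) ∞ (fun y : (U : Opens S) => f y)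
  res {_ _} i _ hf := hf.comp (contMDiff_inclusion i.le)
  locality {U} f hf := by
    intro x
    obtain ⟨U', hx, i, h⟩ := hf x
    exact ((contDiffWithinAt_localInvariantProp (I := 𝓘(ℂ, V)) (I' := 𝓘(ℂ, ℂ))
      ∞).liftPropAt_iff_comp_inclusion (M := S) (U := U') (V := U) i.le f ⟨x, hx⟩).2 (h ⟨x, hx⟩)

/-- The structure sheaf `𝒪` of a complex manifold `S` modelled on `V`. Over an open set `U` it is
the ring of functions `U → ℂ` that are smooth over `ℂ`, that is, of holomorphic functions. -/
def holSheaf : Sheaf (Opens.grothendieckTopology S) RingCat.{u} where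
  obj :=
    { obj := fun U ↦ RingCat.of C^∞⟮𝓘(ℂ, V), (unop U : Opens S); 𝓘(ℂ, ℂ), ℂ⟯
      map := fun h ↦ RingCat.ofHom <|
        ContMDiffMap.restrictRingHom 𝓘(ℂ, V) 𝓘(ℂ, ℂ) ℂ <| leOfHom h.unop
      map_id := fun _ ↦ rfl
      map_comp := fun _ _ ↦ rfl }
  property := by
    rw [Presheaf.isSheaf_iff_isSheaf_forget _ _ (CategoryTheory.forget RingCat)]
    exact TopCat.subpresheafToTypes.isSheaf (holFunctionPredicate V S)

variable {V S}

/-- The value at `x ∈ U` of a holomorphic function on `U`. -/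
def holEval {U : Opens S} (f : (holSheaf V S).obj.obj (op U)) (x : U) : ℂ :=
  (show C^∞⟮𝓘(ℂ, V), U; 𝓘(ℂ, ℂ), ℂ⟯ from f) x

/-- Restriction of sections of a sheaf of `𝒪`-modules. -/
def restrictSection (F : SheafOfModules.{w} (holSheaf V S)) {U U' : Opens S} (h : U' ≤ U)
    (φ : F.val.obj (op U)) : F.val.obj (op U') :=
  F.val.map (homOfLE h).op φ

end StructureSheaf

section SheafMetric

variable {V : Type*} [NormedAddCommGroup V] [NormedSpace ℂ V]
    {S : Type u} [TopologicalSpace S] [ChartedSpace V S]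

/-- A metric on a sheaf `F` of `𝒪`-modules: a morphism of sheaves of sets from `F` to the sheaf of
nonnegative continuous functions with `p (φ + ψ) ≤ p φ + p ψ`, `p (f φ) = |f| p φ`, and
`p φ = 0` if and only if `φ = 0`. -/
structure SheafMetric (F : SheafOfModules.{w} (holSheaf V S)) where
  toFun : ∀ U : Opens S, F.val.obj (op U) → C(U, ℝ≥0)
  restrict : ∀ (U U' : Opens S) (h : U' ≤ U) (φ : F.val.obj (op U)) (x : U'),
    toFun U' (restrictSection F h φ) x = toFun U φ ⟨x, h x.2⟩
  add_le : ∀ (U : Opens S) (φ ψ : F.val.obj (op U)) (x : U),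
    toFun U (φ + ψ) x ≤ toFun U φ x + toFun U ψ x
  smul : ∀ (U : Opens S) (f : (holSheaf V S).obj.obj (op U)) (φ : F.val.obj (op U)) (x : U),
    toFun U (f • φ) x = ‖holEval f x‖₊ * toFun U φ x
  eq_zero_iff : ∀ (U : Opens S) (φ : F.val.obj (op U)), toFun U φ = 0 ↔ φ = 0

/-- A section of `F` over some open neighbourhood of `s`; it represents an element of the stalk
`F_s`. -/
structure LocalSection (F : SheafOfModules.{w} (holSheaf V S)) (s : S) where
  dom : Opens S
  mem : s ∈ dom
  sec : F.val.obj (op dom)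

/-- The sections over `U` of the subsheaf `𝒥(s) F`, near `s`: the submodule of `F(U)` generated by
the products `f χ`, where `f ∈ 𝒪(U)` vanishes at `s` and `χ ∈ F(U)`. -/
def vanishingSubmodule (F : SheafOfModules.{w} (holSheaf V S)) (U : Opens S) (s : S) (hs : s ∈ U) :
    Submodule ((holSheaf V S).obj.obj (op U)) (F.val.obj (op U)) :=
  Submodule.span _ {φ | ∃ f : (holSheaf V S).obj.obj (op U), holEval f ⟨s, hs⟩ = 0 ∧
    ∃ χ : F.val.obj (op U), φ = f • χ}

lemma restrictSection_add (F : SheafOfModules.{w} (holSheaf V S)) {U U' : Opens S} (h : U' ≤ U)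
    (φ ψ : F.val.obj (op U)) :
    restrictSection F h (φ + ψ) = restrictSection F h φ + restrictSection F h ψ :=
  map_add (F.val.map (homOfLE h).op).hom φ ψ

lemma restrictSection_sub (F : SheafOfModules.{w} (holSheaf V S)) {U U' : Opens S} (h : U' ≤ U)
    (φ ψ : F.val.obj (op U)) :
    restrictSection F h (φ - ψ) = restrictSection F h φ - restrictSection F h ψ :=
  map_sub (F.val.map (homOfLE h).op).hom φ ψ

lemma restrictSection_smul (F : SheafOfModules.{w} (holSheaf V S)) {U U' : Opens S} (h : U' ≤ U)
    (f : (holSheaf V S).obj.obj (op U)) (φ : F.val.obj (op U)) :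
    restrictSection F h (f • φ) = (holSheaf V S).obj.map (homOfLE h).op f • restrictSection F h φ :=
  F.val.map_smul _ _ _

lemma restrictSection_restrictSection (F : SheafOfModules.{w} (holSheaf V S)) {U U' U'' : Opens S}
    (h : U' ≤ U) (h' : U'' ≤ U') (φ : F.val.obj (op U)) :
    restrictSection F h' (restrictSection F h φ) = restrictSection F (h'.trans h) φ :=
  (F.val.map_comp_apply (homOfLE h).op (homOfLE h').op φ).symm

lemma restrictSection_mem_vanishingSubmodule (F : SheafOfModules.{w} (holSheaf V S))
    {U U' : Opens S} (h : U' ≤ U) {s : S} (hs : s ∈ U') {φ : F.val.obj (op U)}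
    (hφ : φ ∈ vanishingSubmodule F U s (h hs)) :
    restrictSection F h φ ∈ vanishingSubmodule F U' s hs := by
  induction hφ using Submodule.span_induction with
  | mem x hx =>
    obtain ⟨f, hf, χ, rfl⟩ := hx
    rw [restrictSection_smul]
    exact Submodule.subset_span ⟨_, hf, _, rfl⟩
  | zero => 
    have : restrictSection F h 0 = 0 := map_zero (F.val.map (homOfLE h).op).hom
    rw [this]
    exact zero_mem _
  | add x y _ _ hx hy => 
    rw [restrictSection_add]
    exact add_mem hx hy
  | smul a x _ hx => 
    rw [restrictSection_smul]
    exact Submodule.smul_mem _ _ hx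

/-- Two local sections are identified when their germs at `s` differ by an element of
`(𝒥(s) F)_s`. -/
def fiberSetoid (F : SheafOfModules.{w} (holSheaf V S)) (s : S) : Setoid (LocalSection F s) where
  r φ ψ := ∃ (U : Opens S) (hs : s ∈ U) (h₁ : U ≤ φ.dom) (h₂ : U ≤ ψ.dom),
    restrictSection F h₁ φ.sec - restrictSection F h₂ ψ.sec ∈ vanishingSubmodule F U s hs
  iseqv :=
    { refl := fun φ => ⟨φ.dom, φ.mem, le_rfl, le_rfl, by rw [sub_self]; exact zero_mem _⟩
      symm := fun ⟨U, hs, h₁, h₂, h⟩ => ⟨U, hs, h₂, h₁, by rw [← neg_sub]; exact neg_mem h⟩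
      trans := fun {φ ψ χ} ⟨U, hs, h₁, h₂, h⟩ ⟨U', hs', h₁', h₂', h'⟩ => by
        refine ⟨U ⊓ U', ⟨hs, hs'⟩, inf_le_left.trans h₁, inf_le_right.trans h₂', ?_⟩
        have a := restrictSection_mem_vanishingSubmodule F (U' := U ⊓ U') inf_le_left ⟨hs, hs'⟩ h
        have b := restrictSection_mem_vanishingSubmodule F (U' := U ⊓ U') inf_le_right ⟨hs, hs'⟩ h'
        have c := add_mem a b
        rw [restrictSection_sub, restrictSection_sub, restrictSection_restrictSection,
          restrictSection_restrictSection, restrictSection_restrictSection,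
          restrictSection_restrictSection, sub_add_sub_cancel] at c
        exact c }

/-- The fibre `F^s = F_s / (𝒥(s) F)_s`. -/
def SheafFiber (F : SheafOfModules.{w} (holSheaf V S)) (s : S) : Type _ :=
  Quotient (fiberSetoid F s)

/-- The class in `F^s` of a local section. -/
def LocalSection.toFiber {F : SheafOfModules.{w} (holSheaf V S)} {s : S} (φ : LocalSection F s) :
    SheafFiber F s :=
  Quotient.mk (fiberSetoid F s) φ

namespace SheafMetric

variable {F : SheafOfModules.{w} (holSheaf V S)}

lemma apply_eq_zero_of_mem (p : SheafMetric F) {U : Opens S} {s : S} (hs : s ∈ U)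
    {φ : F.val.obj (op U)} (hφ : φ ∈ vanishingSubmodule F U s hs) : p.toFun U φ ⟨s, hs⟩ = 0 := by
  induction hφ using Submodule.span_induction with
  | mem x hx =>
    obtain ⟨f, hf, χ, rfl⟩ := hx
    rw [p.smul, hf]; simp
  | zero => rw [(p.eq_zero_iff U 0).2 rfl]; rfl
  | add x y _ _ hx hy =>
    refine le_antisymm ((p.add_le _ _ _ _).trans ?_) bot_le
    rw [hx, hy, add_zero]
  | smul a x _ hx => rw [p.smul, hx, mul_zero]

lemma apply_le_of_sub_mem (p : SheafMetric F) {U : Opens S} {s : S} (hs : s ∈ U)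
    {φ ψ : F.val.obj (op U)} (h : φ - ψ ∈ vanishingSubmodule F U s hs) :
    p.toFun U φ ⟨s, hs⟩ ≤ p.toFun U ψ ⟨s, hs⟩ := by
  have := p.add_le U (φ - ψ) ψ ⟨s, hs⟩
  rwa [sub_add_cancel, p.apply_eq_zero_of_mem hs h, zero_add] at this

/-- The seminorm `p^s` induced by `p` on the fibre `F^s`. -/
def fiberNorm (p : SheafMetric F) {s : S} : SheafFiber F s → ℝ≥0 :=
  Quotient.lift (fun φ : LocalSection F s => p.toFun φ.dom φ.sec ⟨s, φ.mem⟩) (by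
    rintro φ ψ ⟨U, hs, h₁, h₂, h⟩
    have a := p.apply_le_of_sub_mem hs h
    rw [← neg_sub] at h
    have b := p.apply_le_of_sub_mem hs (by simpa using neg_mem h)
    rw [p.restrict, p.restrict] at a b
    exact le_antisymm a b)

end SheafMetric

lemma hom_restrictSection {F F' : SheafOfModules.{w} (holSheaf V S)} (α : F ⟶ F') {U U' : Opens S}
    (h : U' ≤ U) (φ : F.val.obj (op U)) :
    α.val.app (op U') (restrictSection F h φ) = restrictSection F' h (α.val.app (op U) φ) :=
  PresheafOfModules.naturality_apply α.val (homOfLE h).op φ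

lemma hom_mem_vanishingSubmodule {F F' : SheafOfModules.{w} (holSheaf V S)} (α : F ⟶ F')
    {U : Opens S} {s : S} (hs : s ∈ U) {φ : F.val.obj (op U)}
    (hφ : φ ∈ vanishingSubmodule F U s hs) :
    α.val.app (op U) φ ∈ vanishingSubmodule F' U s hs := by
  refine (Submodule.span_le (p := (vanishingSubmodule F' U s hs).comap
    (α.val.app (op U)).hom)).2 ?_ hφ
  rintro _ ⟨f, hf, χ, rfl⟩
  exact Submodule.subset_span ⟨f, hf, α.val.app (op U) χ, map_smul (α.val.app (op U)).hom f χ⟩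

/-- The image of a local section under a homomorphism of sheaves. -/
def LocalSection.map {F F' : SheafOfModules.{w} (holSheaf V S)} (α : F ⟶ F') {s : S}
    (φ : LocalSection F s) : LocalSection F' s :=
  ⟨φ.dom, φ.mem, α.val.app (op φ.dom) φ.sec⟩

/-- The map `α^s : F^s → F'^s` induced by a homomorphism `α : F → F'`. -/
def fiberMap {F F' : SheafOfModules.{w} (holSheaf V S)} (α : F ⟶ F') {s : S} :
    SheafFiber F s → SheafFiber F' s :=
  Quotient.map' (s₁ := fiberSetoid F s) (s₂ := fiberSetoid F' s) (LocalSection.map α) (by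
    rintro φ ψ ⟨U, hs, h₁, h₂, h⟩
    refine ⟨U, hs, h₁, h₂, ?_⟩
    have := hom_mem_vanishingSubmodule α hs h
    rw [map_sub, hom_restrictSection, hom_restrictSection] at this
    exact this)

/-- The pointwise norm `‖α‖ : S → [0, ∞]` of a homomorphism: `‖α‖(s)` is the infimum of the
`a ∈ [0, ∞)` with `p' (α φ) (s) ≤ a p φ (s)` for all germs `φ ∈ F_s`. -/
def homNorm {F F' : SheafOfModules.{w} (holSheaf V S)} (p : SheafMetric F) (p' : SheafMetric F')
    (α : F ⟶ F') (s : S) : ℝ≥0∞ :=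
  ⨅ (a : ℝ≥0) (_ : ∀ φ : LocalSection F s,
    p'.toFun φ.dom (α.val.app (op φ.dom) φ.sec) ⟨s, φ.mem⟩ ≤
      a * p.toFun φ.dom φ.sec ⟨s, φ.mem⟩), (a : ℝ≥0∞)

/-- A homomorphism `(F, p) → (F', p')` of sheaves with metrics is a homomorphism `α : F → F'` of
sheaves of `𝒪`-modules for which `‖α‖` is finite and continuous. -/
structure IsMetricHom {F F' : SheafOfModules.{w} (holSheaf V S)} (p : SheafMetric F)
    (p' : SheafMetric F') (α : F ⟶ F') : Prop where
  ne_top : ∀ s, homNorm p p' α s ≠ ⊤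
  continuous : Continuous (homNorm p p' α)

/-- The generalized Levi form in one variable:
`Λ u (z₀) = limsup_{r → 0+} r⁻² (∫₀¹ u (z₀ + r e^{2πiτ}) dτ - u z₀)`. It is only applied to `u`
that are continuous near `z₀`, so that the integrals exist for small `r`. -/
def circleLevi (u : ℂ → ℝ) (z₀ : ℂ) : EReal :=
  Filter.limsup (fun r : ℝ => (((Real.circleAverage u z₀ r - u z₀) / r ^ 2 : ℝ) : EReal)) (𝓝[>] 0)

/-- The generalized Levi form `ξ ξ̄ u ∈ [-∞, ∞]` for `ξ ∈ T_s^{1,0} S`: the infimum of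
`Λ (u ∘ f) (0)` over the holomorphic maps `f` from a neighbourhood of `0 ∈ ℂ` to `S` that send the
tangent vector `∂/∂z` at `0` to `ξ`. Only the values of `u` near `s` matter. -/
def leviForm (u : S → ℝ) {s : S} (ξ : TangentSpace 𝓘(ℂ, V) s) : EReal :=
  ⨅ (f : ℂ → S) (_ : ∀ᶠ z in 𝓝 (0 : ℂ), ContMDiffAt 𝓘(ℂ, ℂ) 𝓘(ℂ, V) ∞ f z)
    (_ : tangentMap 𝓘(ℂ, ℂ) 𝓘(ℂ, V) f ⟨0, (1 : ℂ)⟩ = ⟨s, ξ⟩), circleLevi (u ∘ f) 0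

open Classical in
/-- The function `log p(φ)`, where `φ` is a section over a neighbourhood of `s`. When `p(φ)(s) ≠ 0`
it is continuous near `s`. -/
def SheafMetric.logNorm {F : SheafOfModules.{w} (holSheaf V S)} (p : SheafMetric F) {s : S}
    (φ : LocalSection F s) (x : S) : ℝ :=
  if hx : x ∈ φ.dom then Real.log (p.toFun φ.dom φ.sec ⟨x, hx⟩) else 0

/-- The Griffiths curvature `K_ξ(v)` of `(F, p)`, for `ξ ∈ T_s^{1,0} S` and `v ∈ F^s` with
`p^s(v) ≠ 0`, given by `-K_ξ(v) = 2 inf {ξ ξ̄ log p(φ) (s) : φ ∈ v}`. -/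
def SheafMetric.griffithsCurvature {F : SheafOfModules.{w} (holSheaf V S)} (p : SheafMetric F)
    {s : S} (ξ : TangentSpace 𝓘(ℂ, V) s) (v : SheafFiber F s) : EReal :=
  -(2 * ⨅ (φ : LocalSection F s) (_ : φ.toFiber = v), leviForm (p.logNorm φ) ξ)

end SheafMetric

section Plurisubharmonic

/-- The mean `∫₀¹ u (z + r e^{2πiτ}) dτ` of an extended real valued function over a circle, as the
integral of the positive part minus the integral of the negative part. -/
def ERealCircleMean (u : ℂ → EReal) (z : ℂ) (r : ℝ) : EReal :=
  ((∫⁻ τ in Set.Ioc (0 : ℝ) 1, (u (circleMap z r (2 * Real.pi * τ))).toENNReal : ℝ≥0∞) : EReal) -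
    ((∫⁻ τ in Set.Ioc (0 : ℝ) 1, (-u (circleMap z r (2 * Real.pi * τ))).toENNReal : ℝ≥0∞) : EReal)

/-- Subharmonic functions `u : D → [-∞, ∞)` on an open set `D ⊆ ℂ`: upper semicontinuous and
satisfying the sub-mean value inequality on every closed disc contained in `D`. The constant `-∞`
is allowed. -/
structure IsSubharmonicOn (u : ℂ → EReal) (D : Set ℂ) : Prop where
  upperSemicontinuousOn : UpperSemicontinuousOn u D
  ne_top : ∀ z ∈ D, u z ≠ ⊤
  le_mean : ∀ (z : ℂ) (r : ℝ), 0 < r → Metric.closedBall z r ⊆ D → u z ≤ ERealCircleMean u z r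

/-- Plurisubharmonic functions `u : S → [-∞, ∞)` on a complex manifold: `u` is upper semicontinuous
and `u ∘ f` is subharmonic for every holomorphic map `f` from an open subset of `ℂ` to `S`. -/
structure IsPlurisubharmonic (V : Type*) [NormedAddCommGroup V] [NormedSpace ℂ V]
    {S : Type u} [TopologicalSpace S] [ChartedSpace V S] (u : S → EReal) : Prop where
  upperSemicontinuous : UpperSemicontinuous u
  ne_top : ∀ s, u s ≠ ⊤
  subharmonic_comp : ∀ (D : Set ℂ) (f : ℂ → S), IsOpen D →
    ContMDiffOn 𝓘(ℂ, ℂ) 𝓘(ℂ, V) ∞ f D → IsSubharmonicOn (u ∘ f) D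

end Plurisubharmonic

section HilbertBundle

variable (V : Type*) [NormedAddCommGroup V] [NormedSpace ℂ V]
    {S : Type u} [TopologicalSpace S] [ChartedSpace V S]
    (W : Type*) [NormedAddCommGroup W] 

open Classical in
/-- Extension by zero of a section over an open set. -/
def extendSection {S : Type u} {E : S → Type v} [∀ s, Zero (E s)] {U : Set S}
    (σ : ∀ x : U, E x) (s : S) : E s :=
  if h : s ∈ U then σ ⟨s, h⟩ else 0

lemma extendSection_apply {S : Type u} {E : S → Type v} [∀ s, Zero (E s)] {U : Set S}
    (σ : ∀ x : U, E x) (x : U) : extendSection σ x = σ x := by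
  simp [extendSection]

section
variable [NormedSpace ℂ W]
    (E : S → Type v) [TopologicalSpace (TotalSpace W E)] [∀ s, TopologicalSpace (E s)]
    [FiberBundle W E] 

/-- Holomorphic sections over an open set `U` of a bundle `E`. -/
def IsHolSection {U : Opens S} (σ : ∀ x : U, E x) : Prop :=
  ContMDiff 𝓘(ℂ, V) (𝓘(ℂ, V).prod 𝓘(ℂ, W)) ∞ (fun y : U => (⟨y, σ y⟩ : TotalSpace W E))

variable {E} in
lemma isHolSection_iff [∀ s, Zero (E s)] {U : Opens S} (σ : ∀ x : U, E x) :
    IsHolSection V W E σ ↔ ∀ x ∈ U, ContMDiffAt 𝓘(ℂ, V) (𝓘(ℂ, V).prod 𝓘(ℂ, W)) ∞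
      (fun y : S => (⟨y, extendSection (U := (U : Set S)) σ y⟩ : TotalSpace W E)) x := by
  have : (fun y : U => (⟨y, σ y⟩ : TotalSpace W E)) =
      fun y : U => (⟨y, extendSection (U := (U : Set S)) σ y⟩ : TotalSpace W E) := by
    funext y
    rw [extendSection_apply (U := (U : Set S)) σ y]
  rw [IsHolSection, this]
  exact ⟨fun h x hx => (contMDiffAt_subtype_iff (x := (⟨x, hx⟩ : U))).1 (h ⟨x, hx⟩),
    fun h x => contMDiffAt_subtype_iff.2 (h x x.2)⟩

/-- Holomorphy as a local predicate on sections of `E`. -/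
def holSectionPredicate [∀ s, Zero (E s)] : TopCat.LocalPredicate (X := TopCat.of S) E where
  pred {U} σ := IsHolSection V W E (U := (U : Opens S)) σ
  res {_ _} i _ hσ := ContMDiff.comp hσ (contMDiff_inclusion i.le)
  locality {U} σ hσ := by
    refine (isHolSection_iff V W (U := (U : Opens S)) σ).2 fun x hx => ?_
    obtain ⟨U', hx', i, h⟩ := hσ ⟨x, hx⟩
    refine ((isHolSection_iff V W (U := (U' : Opens S)) _).1 h x hx').congr_of_eventuallyEq ?_
    filter_upwards [U'.isOpen.mem_nhds hx'] with y hy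
    have h1 := extendSection_apply (U := (U' : Set S)) (fun x : U' => σ ⟨x.1, i.le x.2⟩) ⟨y, hy⟩
    have h2 := extendSection_apply (U := (U : Set S)) σ ⟨y, i.le hy⟩
    exact congrArg (TotalSpace.mk' W y) (h2.trans h1.symm)

end

variable [NormedSpace ℂ W]
    (E : S → Type v) [TopologicalSpace (TotalSpace W E)] [∀ s, AddCommGroup (E s)]
    [∀ s, Module ℂ (E s)] [∀ s, TopologicalSpace (E s)]
    [FiberBundle W E] [VectorBundle ℂ W E]

variable {E} in
lemma IsHolSection.add {U : Opens S} {σ τ : ∀ x : U, E x} (hσ : IsHolSection V W E σ)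
    (hτ : IsHolSection V W E τ) : IsHolSection V W E (σ + τ) := by
  rw [isHolSection_iff] at *
  intro x hx
  have : extendSection (U := (U : Set S)) (σ + τ) =
      extendSection (U := (U : Set S)) σ + extendSection (U := (U : Set S)) τ := by
    funext y
    by_cases hy : y ∈ (U : Set S) <;> simp [extendSection, hy]
  rw [this]
  exact (hσ x hx).add_section (hτ x hx)

variable {E} in
lemma IsHolSection.smul {U : Opens S} {σ : ∀ x : U, E x} (f : C^∞⟮𝓘(ℂ, V), U; 𝓘(ℂ, ℂ), ℂ⟯)
    (hσ : IsHolSection V W E σ) : IsHolSection V W E (fun x => f x • σ x) := by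
  rw [isHolSection_iff] at *
  intro x hx
  have hf : ContMDiffAt 𝓘(ℂ, V) 𝓘(ℂ, ℂ) ∞
      (extendSection (E := fun _ => ℂ) (U := (U : Set S)) f) x := by
    refine (contMDiffAt_subtype_iff (U := U) (x := ⟨x, hx⟩)).1 ?_
    have : (fun y : U => extendSection (E := fun _ => ℂ) (U := (U : Set S)) f y) = f := by
      funext y
      exact extendSection_apply (E := fun _ => ℂ) (U := (U : Set S)) f y
    rw [this]
    exact f.contMDiff _
  have : extendSection (U := (U : Set S)) (fun x : U => f x • σ x) =
      extendSection (E := fun _ => ℂ) (U := (U : Set S)) f •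
        extendSection (U := (U : Set S)) σ := by
    funext y
    by_cases hy : y ∈ (U : Set S)
    · simp [extendSection, hy]
    · simp [extendSection, hy]
  rw [this]
  exact hf.smul_section (hσ x hx)

variable {E} in
lemma IsHolSection.neg {U : Opens S} {σ : ∀ x : U, E x} (hσ : IsHolSection V W E σ) :
    IsHolSection V W E (-σ) := by
  have := hσ.smul V W (-1)
  convert! this using 1
  funext x
  simp

variable {E} in
lemma IsHolSection.zero {U : Opens S} : IsHolSection V W E (0 : ∀ x : U, E x) := by
  rw [isHolSection_iff]
  intro x _
  have : extendSection (U := (U : Set S)) (0 : ∀ x : U, E x) = 0 := by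
    funext y
    by_cases hy : y ∈ (U : Set S) <;> simp [extendSection, hy]
  rw [this]
  exact (contMDiff_zeroSection ℂ E) x

/-- The additive group of holomorphic sections of `E` over `U`. -/
def holSections (U : Opens S) : AddSubgroup (∀ x : U, E x) where
  carrier := {σ | IsHolSection V W E σ}
  add_mem' := IsHolSection.add V W
  zero_mem' := IsHolSection.zero V W
  neg_mem' := IsHolSection.neg V W

instance (U : Opens S) : Module C^∞⟮𝓘(ℂ, V), U; 𝓘(ℂ, ℂ), ℂ⟯ (holSections V W E U) where
  smul f σ := ⟨fun x => f x • σ.1 x, σ.2.smul V W f⟩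
  one_smul σ := Subtype.ext <| funext fun x => one_smul ℂ (σ.1 x)
  mul_smul f g σ := Subtype.ext <| funext fun x => mul_smul (f x) (g x) (σ.1 x)
  smul_zero f := Subtype.ext <| funext fun x => smul_zero (f x)
  smul_add f σ τ := Subtype.ext <| funext fun x => smul_add (f x) (σ.1 x) (τ.1 x)
  add_smul f g σ := Subtype.ext <| funext fun x => add_smul (f x) (g x) (σ.1 x)
  zero_smul σ := Subtype.ext <| funext fun x => zero_smul ℂ (σ.1 x)

/-- The presheaf of abelian groups of holomorphic sections of `E`. -/
def holSectionsPresheaf : (Opens S)ᵒᵖ ⥤ Ab.{max u v} where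
  obj U := AddCommGrpCat.of (holSections V W E (unop U))
  map i := AddCommGrpCat.ofHom
    { toFun := fun σ => ⟨fun x => σ.1 ⟨x.1, leOfHom i.unop x.2⟩,
        (holSectionPredicate V W E).res i.unop σ.1 σ.2⟩
      map_zero' := rfl
      map_add' := fun _ _ => rfl }
  map_id _ := rfl
  map_comp _ _ := rfl

instance (U : (Opens S)ᵒᵖ) :
    Module ((holSheaf V S).obj.obj U) ((holSectionsPresheaf V W E).obj U) :=
  inferInstanceAs (Module C^∞⟮𝓘(ℂ, V), (unop U : Opens S); 𝓘(ℂ, ℂ), ℂ⟯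
    (holSections V W E (unop U)))

/-- The sheaf of `𝒪`-modules of (smooth over `ℂ`, that is) holomorphic sections of the holomorphic vector bundle `E`. -/
def sectionSheaf : SheafOfModules.{max u v} (holSheaf V S) where
  val := PresheafOfModules.ofPresheaf (holSectionsPresheaf V W E) (fun _ _ _ _ _ => rfl)
  isSheaf := by
    change Presheaf.IsSheaf (Opens.grothendieckTopology S) (holSectionsPresheaf V W E)
    have : Limits.ReflectsLimitsOfSize.{u, u} (CategoryTheory.forget Ab.{max u v}) :=
      Limits.reflectsLimits_of_reflectsIsomorphisms
    exact Presheaf.isSheaf_of_isSheaf_comp _ _ (CategoryTheory.forget Ab.{max u v})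
      (TopCat.subpresheafToTypes.isSheaf (holSectionPredicate V W E))

variable {V W E}

/-- The value at `x ∈ U` of a holomorphic section of `E` over `U`. -/
def sectionEval {U : Opens S} (σ : (sectionSheaf V W E).val.obj (op U)) (x : U) : E x :=
  (show holSections V W E U from σ).1 x

end HilbertBundle

section HermitianMetric

/-- A hermitian metric of class `C²` on the holomorphic Hilbert bundle `E → S` with fibre `W`. In
every local trivialization of `E` (with coordinates `e v ∈ W` for `v ∈ E_s`) it has the form
`h(v, w) = ⟨P(s) (e v), e w⟩`, where `P` is a `C²` map (in the real sense) to the bounded operators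
on `W`, with self-adjoint, invertible and positive values. Here `h` and `⟨ , ⟩` are linear in the first
variable, while `inner ℂ` is linear in the second: `⟨a, b⟩ = inner ℂ b a`. -/
structure HermitianMetric (V : Type*) [NormedAddCommGroup V] [NormedSpace ℂ V]
    {S : Type u} [TopologicalSpace S] [ChartedSpace V S]
    (W : Type*) [NormedAddCommGroup W] [InnerProductSpace ℂ W] [CompleteSpace W]
    (E : S → Type v) [TopologicalSpace (TotalSpace W E)] [∀ s, AddCommGroup (E s)]
    [∀ s, Module ℂ (E s)] [∀ s, TopologicalSpace (E s)]
    [FiberBundle W E] where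
  toFun : ∀ s : S, E s → E s → ℂ
  exists_gram : ∀ (e : Trivialization W (π W E)) [MemTrivializationAtlas e],
    ∃ P : S → (W →L[ℂ] W), ContMDiffOn 𝓘(ℝ, V) 𝓘(ℝ, W →L[ℂ] W) 2 P e.baseSet ∧
      ∀ s ∈ e.baseSet, IsSelfAdjoint (P s) ∧ IsUnit (P s) ∧
        (∀ w : W, w ≠ 0 → 0 < (inner ℂ w (P s w)).re) ∧
        ∀ v w : E s, toFun s v w = inner ℂ (e ⟨s, w⟩).2 (P s (e ⟨s, v⟩).2)

lemma sqrt_re_inner_add_le {W : Type*} [NormedAddCommGroup W] [InnerProductSpace ℂ W]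
    [CompleteSpace W] {P : W →L[ℂ] W} (hP : IsSelfAdjoint P)
    (hpos : ∀ w : W, w ≠ 0 → 0 < (inner ℂ w (P w)).re) (v w : W) :
    √(inner ℂ (v + w) (P (v + w))).re ≤ √(inner ℂ v (P v)).re + √(inner ℂ w (P w)).re := by
  have hsymm : ∀ x y, inner ℂ (P x) y = inner ℂ x (P y) := fun x y => by
    conv_rhs => rw [← hP.adjoint_eq]
    exact (ContinuousLinearMap.adjoint_inner_right P x y).symm
  let c : InnerProductSpace.Core ℂ W :=
    { inner := fun x y => inner ℂ x (P y)
      conj_inner_symm := fun x y => by rw [inner_conj_symm, hsymm]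
      re_inner_nonneg := fun x => by
        by_cases hx : x = 0
        · simp [hx]
        · exact (hpos x hx).le
      add_left := fun x y z => inner_add_left _ _ _
      smul_left := fun x y r => inner_smul_left _ _ _
      definite := fun x hx => by
        by_contra h
        have := hpos x h
        rw [hx] at this
        simp at this }
  let n := c.toNormedAddCommGroup
  exact norm_add_le v w

variable {V : Type*} [NormedAddCommGroup V] [NormedSpace ℂ V]
    {S : Type u} [TopologicalSpace S] [ChartedSpace V S]
    {W : Type*} [NormedAddCommGroup W] [InnerProductSpace ℂ W] [CompleteSpace W]
    {E : S → Type v} [TopologicalSpace (TotalSpace W E)] [∀ s, AddCommGroup (E s)]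
    [∀ s, Module ℂ (E s)] [∀ s, TopologicalSpace (E s)]
    [FiberBundle W E] [VectorBundle ℂ W E]

namespace HermitianMetric

/-- The norm `h(v, v)^{1/2}` of `v ∈ E_s`. -/
def norm (h : HermitianMetric V W E) {s : S} (v : E s) : ℝ≥0 :=
  Real.toNNReal √(h.toFun s v v).re

lemma norm_add_le (h : HermitianMetric V W E) {s : S} (v w : E s) :
    h.norm (v + w) ≤ h.norm v + h.norm w := by
  obtain ⟨P, -, hP⟩ := h.exists_gram (trivializationAt W E s)
  obtain ⟨h1, -, h2, h3⟩ := hP s (FiberBundle.mem_baseSet_trivializationAt' s)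
  have hadd : (trivializationAt W E s ⟨s, v + w⟩).2 =
      (trivializationAt W E s ⟨s, v⟩).2 + (trivializationAt W E s ⟨s, w⟩).2 :=
    ((trivializationAt W E s).linear ℂ (FiberBundle.mem_baseSet_trivializationAt' s)).map_add v w
  rw [norm, norm, norm, ← Real.toNNReal_add (Real.sqrt_nonneg _) (Real.sqrt_nonneg _)]
  refine Real.toNNReal_le_toNNReal ?_
  rw [h3, h3, h3, hadd]
  exact sqrt_re_inner_add_le h1 h2 _ _

lemma norm_smul (h : HermitianMetric V W E) {s : S} (c : ℂ) (v : E s) :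
    h.norm (c • v) = ‖c‖₊ * h.norm v := by
  obtain ⟨P, -, hP⟩ := h.exists_gram (trivializationAt W E s)
  obtain ⟨-, -, -, h3⟩ := hP s (FiberBundle.mem_baseSet_trivializationAt' s)
  have hsmul : (trivializationAt W E s ⟨s, c • v⟩).2 = c • (trivializationAt W E s ⟨s, v⟩).2 :=
    ((trivializationAt W E s).linear ℂ (FiberBundle.mem_baseSet_trivializationAt' s)).map_smul c v
  have key : h.toFun s (c • v) (c • v) = ((‖c‖ ^ 2 : ℝ) : ℂ) * h.toFun s v v := by
    rw [h3, h3, hsmul, map_smul, inner_smul_left, inner_smul_right, ← mul_assoc,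
      Complex.conj_mul']
    push_cast
    rfl
  ext
  rw [NNReal.coe_mul, norm, norm, Real.coe_toNNReal _ (Real.sqrt_nonneg _),
    Real.coe_toNNReal _ (Real.sqrt_nonneg _), key, Complex.re_ofReal_mul,
    Real.sqrt_mul (sq_nonneg _), Real.sqrt_sq (norm_nonneg _), coe_nnnorm]

lemma norm_eq_zero_iff (h : HermitianMetric V W E) {s : S} (v : E s) : h.norm v = 0 ↔ v = 0 := by
  obtain ⟨P, -, hP⟩ := h.exists_gram (trivializationAt W E s)
  obtain ⟨-, -, h2, h3⟩ := hP s (FiberBundle.mem_baseSet_trivializationAt' s)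
  constructor
  · intro hv
    by_contra hne
    have hw : (trivializationAt W E s ⟨s, v⟩).2 ≠ 0 := fun h0 => hne <| by
      let L := (trivializationAt W E s).continuousLinearEquivAt ℂ s
        (FiberBundle.mem_baseSet_trivializationAt' s)
      exact L.injective ((show L v = 0 from h0).trans (map_zero L).symm)
    have := h2 _ hw
    rw [norm, Real.toNNReal_eq_zero, h3] at hv
    exact absurd hv (not_le.2 (Real.sqrt_pos.2 this))
  · rintro rfl
    have := h.norm_smul (0 : ℂ) (0 : E s)
    simpa using this

lemma continuous_norm (h : HermitianMetric V W E) {U : Opens S} {σ : ∀ x : U, E x}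
    (hσ : IsHolSection V W E σ) : Continuous fun x : U => h.norm (σ x) := by
  rw [continuous_iff_continuousAt]
  intro x
  set e := trivializationAt W E (x : S) with he
  obtain ⟨P, hPc, hP⟩ := h.exists_gram e
  have hx : (x : S) ∈ e.baseSet := FiberBundle.mem_baseSet_trivializationAt' _
  have h1 : ContinuousAt (fun y : U => (⟨y, σ y⟩ : TotalSpace W E)) x :=
    (ContMDiff.continuous hσ).continuousAt
  have h2 : ContinuousAt (fun y : U => (e ⟨y, σ y⟩).2) x :=
    (ContinuousAt.comp (f := fun y : U => (⟨y, σ y⟩ : TotalSpace W E))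
      (e.continuousAt (e.mem_source.2 hx)) h1).snd
  have h3 : ContinuousAt (fun y : U => P y) x :=
    ContinuousAt.comp (f := fun y : U => (y : S))
      (hPc.continuousOn.continuousAt (e.open_baseSet.mem_nhds hx)) continuousAt_subtype_val
  have h4 : ContinuousAt (fun y : U => Real.toNNReal
      √(inner ℂ (e ⟨y, σ y⟩).2 (P y (e ⟨y, σ y⟩).2)).re) x :=
    continuous_real_toNNReal.continuousAt.comp <| Real.continuous_sqrt.continuousAt.comp <|
      Complex.continuous_re.continuousAt.comp <| h2.inner (h3.clm_apply h2)
  refine h4.congr ?_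
  filter_upwards [continuousAt_subtype_val.preimage_mem_nhds (e.open_baseSet.mem_nhds hx)]
    with y hy
  rw [norm, (hP y hy).2.2.2]

/-- The metric `p(φ) = h(φ, φ)^{1/2}` on the sheaf of holomorphic sections of a hermitian
holomorphic Hilbert bundle. -/
def sheafMetric (h : HermitianMetric V W E) : SheafMetric (sectionSheaf V W E) where
  toFun _ φ := ⟨fun x => h.norm (sectionEval φ x),
    h.continuous_norm (show holSections V W E _ from φ).2⟩
  restrict _ _ _ _ _ := rfl
  add_le _ _ _ _ := h.norm_add_le _ _
  smul _ _ _ _ := h.norm_smul _ _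
  eq_zero_iff U φ := by
    constructor
    · intro h0
      refine Subtype.ext (funext fun x => ?_)
      exact (h.norm_eq_zero_iff _).1 (DFunLike.congr_fun h0 x)
    · rintro rfl
      ext1 x
      exact (h.norm_eq_zero_iff _).2 rfl

end HermitianMetric

end HermitianMetric

end

noncomputable section

/-! ### Maximum principle and sub-mean value inequality for functions with a lower bound on
`circleLevi`. -/

section Subharmonic

open Metric

/-! At a point `s` the norm of `α` is the supremum of `p'(αφ)(s) / p(φ)(s)` over germs `φ` with
`φ(s) ≠ 0`. A supremum of functions with subharmonic logarithm is well behaved, so one looks for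
sections `φ` along a holomorphic curve `f` for which `log p'(αφ) - log p(φ)` is almost subharmonic.
The curvature hypothesis says that the Levi form of `log p'(αφ)` is at least the infimum of the Levi
forms of `log p(ψ)` over all `ψ` with the same class as `φ` and all curves with the same tangent.
Hence it suffices that `φ` itself nearly realizes this infimum.

In a trivialization with Gram operator `Q` along the curve and coordinate `y` of the section, the
Levi form of `log ⟨Q y, y⟩ / 2` depends on `y'` only through the covariant derivative `y' + a`,
where `Q a = (∂Q) y` (`HasLevi.log_gram`). By Cauchy–Schwarz this contribution is nonnegative, so
the infimum is approached when `y' + a` is small. The sections `w - T (x - x₀) w` with `T = P⁻¹ ∂P`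
at the centre have `y' + a = 0` there, hence `y' + a` small nearby, on a neighbourhood independent
of `w` (`exists_eventually_almost_flat`, `HermitianMetric.exists_almost_flat_sections`). This
uniformity is essential: the supremum over an infinite dimensional fibre need not be attained.

So for every `ε` the quotients `p'(αφ) / p(φ)` have logarithmic Levi form at least `-ε` on a fixed
disc. The maximum principle `le_exp_of_le_circleLevi` compares them with `exp (Re p)`, `p` entire,
with error `ε r²`; taking the supremum over `w` at the centre passes this to `‖α‖`
(`HermitianMetric.eventually_homNorm_le_exp`). Letting `ε → 0` gives `Λ log ‖α‖ ≥ 0` wherever `‖α‖ ≠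
0` (`circleLevi_nonneg`). A second use of the maximum principle, now with `c = 0` on an arbitrary
disc, and density of the functions `Re p` on circles turn this into the sub-mean value inequality
(`log_le_eRealCircleMean`). Upper semicontinuity is immediate because `‖α‖` is continuous. -/

lemma circleAverage_re_of_differentiable {p : ℂ → ℂ} (hp : Differentiable ℂ p) (z : ℂ) (r : ℝ) :
    Real.circleAverage (fun ζ => (p ζ).re) z r = (p z).re := by
  have h1 := Complex.reCLM.circleAverage_comp_comm (c := z) (R := r)
    hp.continuous.continuousOn.circleIntegrable'
  have h2 : Real.circleAverage p z r = p z := DiffContOnCl.circleAverage hp.diffContOnCl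
  rw [h2] at h1
  exact h1

lemma circleIntegrable_of_eventually_continuousAt {E : Type*} [NormedAddCommGroup E] {u : ℂ → E}
    {z : ℂ} (hu : ∀ᶠ ζ in 𝓝 z, ContinuousAt u ζ) : ∀ᶠ r in 𝓝 (0 : ℝ), CircleIntegrable u z r := by
  obtain ⟨δ, hδ, h⟩ := Metric.eventually_nhds_iff_ball.1 hu
  filter_upwards [Metric.ball_mem_nhds (0 : ℝ) hδ] with r hr
  refine ContinuousOn.circleIntegrable' fun ζ hζ => (h ζ ?_).continuousWithinAt
  rw [mem_ball_zero_iff, Real.norm_eq_abs] at hr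
  rw [mem_sphere] at hζ
  rw [mem_ball, hζ]
  exact hr

lemma eventually_forall_mem_sphere {P : ℂ → Prop} {z : ℂ} (hP : ∀ᶠ ζ in 𝓝 z, P ζ) :
    ∀ᶠ r in 𝓝 (0 : ℝ), ∀ ζ ∈ sphere z |r|, P ζ := by
  obtain ⟨δ, hδ, h⟩ := Metric.eventually_nhds_iff_ball.1 hP
  filter_upwards [Metric.ball_mem_nhds (0 : ℝ) hδ] with r hr ζ hζ
  refine h ζ ?_
  rw [mem_ball_zero_iff, Real.norm_eq_abs] at hr
  rw [mem_sphere] at hζ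
  rw [mem_ball, hζ]
  exact hr

/-- A function that lies below `u z + Re (p - p z) - k (|ζ - z₀|² - |z - z₀|²)`, where `p` is
entire, has generalized Levi form at most `-k` at `z`. -/
lemma circleLevi_le_of_eventually_le {u : ℂ → ℝ} {z z₀ : ℂ} {k : ℝ} {p : ℂ → ℂ}
    (hu : ∀ᶠ ζ in 𝓝 z, ContinuousAt u ζ) (hp : Differentiable ℂ p)
    (h : ∀ᶠ ζ in 𝓝 z, u ζ - (p ζ).re + k * ‖ζ - z₀‖ ^ 2 ≤ u z - (p z).re + k * ‖z - z₀‖ ^ 2) :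
    circleLevi u z ≤ ((-k : ℝ) : EReal) := by
  -- Expanding `‖ζ - z₀‖²` around `z` produces `‖ζ - z‖²` plus a harmonic term; the latter is
  -- absorbed into `q`. On the circle of radius `r` about `z`, `u` is then at most `Re q - k r²`,
  -- whose mean is `u z - k r²`.
  set q : ℂ → ℂ := fun ζ => p ζ + (u z - (p z).re : ℝ) -
    k * (2 * (ζ - z) * (starRingEnd ℂ) (z - z₀)) with hq
  have hqd : Differentiable ℂ q := by
    rw [hq]
    fun_prop
  have hqz : (q z).re = u z := by simp [hq]
  have hle : ∀ ζ, u ζ - (p ζ).re + k * ‖ζ - z₀‖ ^ 2 ≤ u z - (p z).re + k * ‖z - z₀‖ ^ 2 →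
      u ζ ≤ (q ζ).re - k * ‖ζ - z‖ ^ 2 := by
    intro ζ hζ
    have e1 : ‖ζ - z₀‖ ^ 2 = ‖ζ - z‖ ^ 2 + (2 * (ζ - z) * (starRingEnd ℂ) (z - z₀)).re +
        ‖z - z₀‖ ^ 2 := by
      rw [← Complex.normSq_eq_norm_sq, ← Complex.normSq_eq_norm_sq, ← Complex.normSq_eq_norm_sq]
      simp [Complex.normSq_apply]
      ring
    have e2 : (q ζ).re = (p ζ).re + (u z - (p z).re) -
        k * (2 * (ζ - z) * (starRingEnd ℂ) (z - z₀)).re := by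
      simp only [hq, Complex.sub_re, Complex.add_re, Complex.ofReal_re, Complex.re_ofReal_mul]
    rw [e1] at hζ
    rw [e2]
    linarith
  refine Filter.limsup_le_of_le (by isBoundedDefault) ?_
  have hpos : ∀ᶠ r : ℝ in 𝓝[>] 0, 0 < r := eventually_mem_nhdsWithin
  filter_upwards [hpos, nhdsWithin_le_nhds (circleIntegrable_of_eventually_continuousAt hu),
    nhdsWithin_le_nhds (eventually_forall_mem_sphere h)] with r hr hi hs
  rw [EReal.coe_le_coe_iff, div_le_iff₀ (by positivity)]
  have h1 : Real.circleAverage u z r ≤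
      Real.circleAverage (fun ζ => (q ζ - (k * r ^ 2 : ℝ)).re) z r := by
    refine Real.circleAverage_mono hi ?_ fun ζ hζ => ?_
    · refine ContinuousOn.circleIntegrable' (Continuous.continuousOn ?_)
      have := hqd.continuous
      fun_prop
    · refine (hle ζ (hs ζ hζ)).trans (le_of_eq ?_)
      rw [mem_sphere, dist_eq_norm, abs_of_pos hr] at hζ
      rw [Complex.sub_re (q ζ), Complex.ofReal_re, hζ]
  rw [circleAverage_re_of_differentiable (hqd.sub_const _), Complex.sub_re, hqz,
    Complex.ofReal_re] at h1
  linarith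

/-- Comparison with exponentials of harmonic functions: if `log N` has generalized Levi form at
least `-c` wherever `N ≠ 0`, and `N ≤ exp (Re p)` on the boundary of a disc, then
`N ≤ exp (Re p + c r²)` at the centre. -/
lemma le_exp_of_le_circleLevi {N : ℂ → ℝ} {z₀ : ℂ} {r c : ℝ} (hr : 0 < r)
    (hN : ContinuousOn N (closedBall z₀ r)) (hpos : ∀ z ∈ closedBall z₀ r, 0 ≤ N z)
    (hΛ : ∀ z ∈ ball z₀ r, N z ≠ 0 →
      ((-c : ℝ) : EReal) ≤ circleLevi (fun ζ => Real.log (N ζ)) z)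
    {p : ℂ → ℂ} (hp : Differentiable ℂ p)
    (hb : ∀ z ∈ sphere z₀ r, N z ≤ Real.exp (p z).re) :
    N z₀ ≤ Real.exp ((p z₀).re + c * r ^ 2) := by
  -- Enlarging `c` to `k = c + ε` makes the contradiction at an interior maximum strict.
  have key : ∀ ε : ℝ, 0 < ε → N z₀ ≤ Real.exp ((p z₀).re + (c + ε) * r ^ 2) := by
    intro ε hε
    set k := c + ε with hk
    -- Working with this product instead of its logarithm keeps `G` continuous at zeros of `N`. A
    -- maximum with `N z₁ = 0` or on the boundary gives the bound; at any other one
    -- `circleLevi_le_of_eventually_le` yields a Levi form at most `-k < -c`.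
    set G : ℂ → ℝ := fun z => N z * Real.exp (-(p z).re + k * ‖z - z₀‖ ^ 2) with hG
    have hGc : ContinuousOn G (closedBall z₀ r) := by
      refine hN.mul (Continuous.continuousOn ?_)
      have := hp.continuous
      fun_prop
    obtain ⟨z₁, hz₁, hmax⟩ := (isCompact_closedBall z₀ r).exists_isMaxOn
      ⟨z₀, mem_closedBall_self hr.le⟩ hGc
    have hz₀ : G z₀ ≤ G z₁ := hmax (mem_closedBall_self hr.le)
    have hG1 : G z₁ ≤ Real.exp (k * r ^ 2) := by
      by_cases hzero : N z₁ = 0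
      · simp only [hG, hzero, zero_mul]
        positivity
      by_cases hz₁' : z₁ ∈ sphere z₀ r
      · have := hb z₁ hz₁'
        rw [mem_sphere, dist_eq_norm] at hz₁'
        simp only [hG, hz₁']
        calc _ ≤ Real.exp (p z₁).re * Real.exp (-(p z₁).re + k * r ^ 2) := by gcongr
          _ = _ := by rw [← Real.exp_add]; ring_nf
      exfalso
      have hin : z₁ ∈ ball z₀ r := by
        rw [mem_closedBall] at hz₁
        rw [mem_sphere] at hz₁'
        exact lt_of_le_of_ne hz₁ hz₁'
      have hnhds : ∀ᶠ ζ in 𝓝 z₁, ζ ∈ ball z₀ r := isOpen_ball.mem_nhds hin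
      have hNc : ∀ ζ ∈ ball z₀ r, ContinuousAt N ζ := fun ζ hζ =>
        hN.continuousAt (Filter.mem_of_superset (isOpen_ball.mem_nhds hζ) ball_subset_closedBall)
      have hne : ∀ᶠ ζ in 𝓝 z₁, N ζ ≠ 0 := (hNc z₁ hin).eventually_ne hzero
      have := circleLevi_le_of_eventually_le (u := fun ζ => Real.log (N ζ)) (z := z₁) (z₀ := z₀)
        (k := k) (p := p) ?_ hp ?_
      · have h2 := (hΛ z₁ hin hzero).trans this
        rw [EReal.coe_le_coe_iff] at h2
        linarith
      · filter_upwards [hnhds, hne] with ζ h1 h2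
        exact (hNc ζ h1).log h2
      · filter_upwards [hnhds, hne] with ζ h1 h2
        have p1 := lt_of_le_of_ne (hpos ζ (ball_subset_closedBall h1)) h2.symm
        have p2 := lt_of_le_of_ne (hpos z₁ hz₁) (Ne.symm hzero)
        have h3 : G ζ ≤ G z₁ := hmax (ball_subset_closedBall h1)
        have h4 := Real.log_le_log (by simp only [hG]; positivity) h3
        simp only [hG] at h4
        rw [Real.log_mul p1.ne' (Real.exp_ne_zero _), Real.log_mul p2.ne' (Real.exp_ne_zero _),
          Real.log_exp, Real.log_exp] at h4
        linarith
    have h5 := hz₀.trans hG1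
    simp only [hG, sub_self, norm_zero] at h5
    rw [Real.exp_add]
    calc N z₀ = Real.exp (p z₀).re * (N z₀ * Real.exp (-(p z₀).re + k * 0 ^ 2)) := by
          rw [mul_left_comm, ← Real.exp_add]; simp
      _ ≤ _ := by gcongr
  have hcont : Filter.Tendsto (fun ε : ℝ => Real.exp ((p z₀).re + (c + ε) * r ^ 2)) (𝓝[>] 0)
      (𝓝 (Real.exp ((p z₀).re + c * r ^ 2))) := by
    have : ContinuousAt (fun ε : ℝ => Real.exp ((p z₀).re + (c + ε) * r ^ 2)) 0 := by fun_prop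
    have h2 := this.tendsto
    rw [add_zero] at h2
    exact h2.mono_left nhdsWithin_le_nhds
  exact ge_of_tendsto hcont (eventually_mem_nhdsWithin.mono key)

/-- Real parts of entire functions are uniformly dense in the continuous functions on a circle. -/
lemma exists_differentiable_re_approx {φ : ℂ → ℝ} {z₀ : ℂ} {r ε : ℝ} (hr : 0 < r)
    (hφ : ContinuousOn φ (sphere z₀ r)) (hε : 0 < ε) :
    ∃ p : ℂ → ℂ, Differentiable ℂ p ∧
      ∀ z ∈ sphere z₀ r, φ z ≤ (p z).re ∧ (p z).re ≤ φ z + ε := by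
  have : Fact (0 < 2 * Real.pi) := ⟨Real.two_pi_pos⟩
  set P : AddCircle (2 * Real.pi) → ℂ := fun θ => z₀ + r * (AddCircle.toCircle θ : ℂ) with hP
  have hPc : Continuous P := by
    have := AddCircle.continuous_toCircle (T := 2 * Real.pi)
    fun_prop
  have hPs : ∀ θ, P θ ∈ sphere z₀ r := fun θ => by
    simp [hP, abs_of_pos hr, Circle.norm_coe]
  have hsurj : ∀ z ∈ sphere z₀ r, ∃ θ, P θ = z := by
    intro z hz
    rw [mem_sphere, dist_eq_norm] at hz
    have h1 : (z - z₀) / r ∈ Submonoid.unitSphere ℂ := by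
      simp [Submonoid.unitSphere, hz, abs_of_pos hr, hr.ne']
    obtain ⟨θ, hθ⟩ := (AddCircle.homeomorphCircle (T := 2 * Real.pi)
      Real.two_pi_pos.ne').surjective ⟨(z - z₀) / r, h1⟩
    refine ⟨θ, ?_⟩
    rw [AddCircle.homeomorphCircle_apply] at hθ
    have : (r : ℂ) ≠ 0 := by exact_mod_cast hr.ne'
    simp only [hP, hθ]
    field_simp
    ring
  -- The characters are the powers of `(z - z₀) / r` and their conjugates, so a trigonometric
  -- polynomial is `p + conj q`, with the same real part as the entire function `p + q`.
  have hspan : ∀ g ∈ Submodule.span ℂ (Set.range (@fourier (2 * Real.pi))), ∃ p q : ℂ → ℂ,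
      Differentiable ℂ p ∧ Differentiable ℂ q ∧
        ∀ θ, g θ = p (P θ) + (starRingEnd ℂ) (q (P θ)) := by
    intro g hg
    induction hg using Submodule.span_induction with
    | mem x hx =>
      obtain ⟨n, rfl⟩ := hx
      have e : ∀ θ, (P θ - z₀) / r = (AddCircle.toCircle θ : ℂ) := fun θ => by
        have : (r : ℂ) ≠ 0 := by exact_mod_cast hr.ne'
        simp only [hP]
        field_simp
        ring
      obtain ⟨m, rfl | rfl⟩ := n.eq_nat_or_neg
      · refine ⟨fun z => ((z - z₀) / r) ^ m, fun _ => 0, by fun_prop, by fun_prop, fun θ => ?_⟩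
        simp only [e, fourier_apply, AddCircle.toCircle_zsmul]
        simp
      · refine ⟨fun _ => 0, fun z => ((z - z₀) / r) ^ m, by fun_prop, by fun_prop, fun θ => ?_⟩
        simp only [e, fourier_apply, AddCircle.toCircle_zsmul]
        simp [← Circle.coe_inv_eq_conj]
    | zero => exact ⟨0, 0, differentiable_const _, differentiable_const _, fun θ => by simp⟩
    | add x y _ _ hx hy =>
      obtain ⟨p, q, hp, hq, h⟩ := hx
      obtain ⟨p', q', hp', hq', h'⟩ := hy
      refine ⟨p + p', q + q', hp.add hp', hq.add hq', fun θ => ?_⟩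
      simp only [ContinuousMap.add_apply, h, h', Pi.add_apply, map_add]
      ring
    | smul a x _ hx =>
      obtain ⟨p, q, hp, hq, h⟩ := hx
      refine ⟨a • p, (starRingEnd ℂ a) • q, hp.const_smul _, hq.const_smul _, fun θ => ?_⟩
      simp only [ContinuousMap.smul_apply, h, Pi.smul_apply, smul_eq_mul, map_mul,
        Complex.conj_conj]
      ring
  have hφc : Continuous fun θ => φ (P θ) := hφ.comp_continuous hPc hPs
  -- The shift by `ε / 2` turns a two-sided approximation within `ε / 2` into one lying between `φ`
  -- and `φ + ε`.
  let F : C(AddCircle (2 * Real.pi), ℂ) := ⟨fun θ => ((φ (P θ) + ε / 2 : ℝ) : ℂ),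
    Complex.continuous_ofReal.comp (hφc.add_const _)⟩
  have hF : F ∈ (Submodule.span ℂ (Set.range (@fourier (2 * Real.pi)))).topologicalClosure := by
    rw [span_fourier_closure_eq_top]
    trivial
  obtain ⟨g, hg, hgF⟩ := Metric.mem_closure_iff.1 hF (ε / 2) (half_pos hε)
  obtain ⟨p, q, hp, hq, h⟩ := hspan g hg
  refine ⟨p + q, hp.add hq, fun z hz => ?_⟩
  obtain ⟨θ, rfl⟩ := hsurj z hz
  have h1 : dist (F θ) (g θ) < ε / 2 := (ContinuousMap.dist_apply_le_dist θ).trans_lt hgF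
  have h2 : |(F θ - g θ).re| < ε / 2 :=
    (Complex.abs_re_le_norm _).trans_lt (by rwa [← dist_eq_norm])
  have h3 : (F θ).re = φ (P θ) + ε / 2 := rfl
  have h4 : (g θ).re = ((p + q) (P θ)).re := by simp [h]
  rw [Complex.sub_re, h3, h4, abs_lt] at h2
  constructor <;> linarith

/-- If `N` is dominated at the centre of a circle by `exp (Re p + c)` for all entire `p` with
`N ≤ exp (Re p)` on the circle, then `N ≤ exp (c + mean of φ)` for all continuous `φ ≥ log N`. -/
lemma le_exp_circleAverage {N φ : ℂ → ℝ} {z₀ : ℂ} {r c : ℝ} (hr : 0 < r)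
    (h : ∀ p : ℂ → ℂ, Differentiable ℂ p → (∀ z ∈ sphere z₀ r, N z ≤ Real.exp (p z).re) →
      N z₀ ≤ Real.exp ((p z₀).re + c))
    (hφ : ContinuousOn φ (sphere z₀ r)) (hN : ∀ z ∈ sphere z₀ r, N z ≤ Real.exp (φ z)) :
    N z₀ ≤ Real.exp (Real.circleAverage φ z₀ r + c) := by
  have key : ∀ ε : ℝ, 0 < ε → N z₀ ≤ Real.exp (Real.circleAverage φ z₀ r + ε + c) := by
    intro ε hε
    obtain ⟨p, hp, hpφ⟩ := exists_differentiable_re_approx hr hφ hε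
    refine (h p hp fun z hz => (hN z hz).trans (Real.exp_le_exp.2 (hpφ z hz).1)).trans ?_
    rw [Real.exp_le_exp]
    have hφ' : ContinuousOn φ (sphere z₀ |r|) := by rwa [abs_of_pos hr]
    have h1 : Real.circleAverage (fun ζ => (p ζ).re) z₀ r ≤
        Real.circleAverage (fun ζ => φ ζ + ε) z₀ r := by
      refine Real.circleAverage_mono ?_ ?_ fun ζ hζ => ?_
      · have := hp.continuous
        exact ContinuousOn.circleIntegrable' (Continuous.continuousOn (by fun_prop))
      · exact (hφ'.add continuousOn_const).circleIntegrable'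
      · rw [abs_of_pos hr] at hζ
        exact (hpφ ζ hζ).2
    rw [circleAverage_re_of_differentiable hp, Real.circleAverage_fun_add
      hφ'.circleIntegrable' continuousOn_const.circleIntegrable', Real.circleAverage_const] at h1
    linarith
  have hcont : Filter.Tendsto (fun ε : ℝ => Real.exp (Real.circleAverage φ z₀ r + ε + c)) (𝓝[>] 0)
      (𝓝 (Real.exp (Real.circleAverage φ z₀ r + c))) := by
    have : ContinuousAt (fun ε : ℝ => Real.exp (Real.circleAverage φ z₀ r + ε + c)) 0 := by
      fun_prop
    have h2 := this.tendsto
    rw [add_zero] at h2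
    exact h2.mono_left nhdsWithin_le_nhds
  exact ge_of_tendsto hcont (eventually_mem_nhdsWithin.mono key)

lemma circleAverage_eq_integral_Ioc (φ : ℂ → ℝ) (z : ℂ) (r : ℝ) :
    Real.circleAverage φ z r = ∫ τ in Set.Ioc (0 : ℝ) 1, φ (circleMap z r (2 * Real.pi * τ)) := by
  rw [← intervalIntegral.integral_of_le zero_le_one, intervalIntegral.integral_comp_mul_left
    (f := fun θ => φ (circleMap z r θ)) Real.two_pi_pos.ne', mul_zero, mul_one]
  rfl

/-- Because `exp (-n) ≤ 1`, truncating `N` from below at this level does not change the positive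
part of its logarithm. -/
lemma ofReal_log_max (N : ℝ≥0) (n : ℕ) :
    ENNReal.ofReal (Real.log (max (N : ℝ) (Real.exp (-n)))) = (ENNReal.log N).toENNReal := by
  have hn : -(n : ℝ) ≤ 0 := by simp
  obtain rfl | hN := eq_or_ne N 0
  · simp [(Real.exp_pos _).le]
  have hpos : (0 : ℝ) < N := by exact_mod_cast hN.bot_lt
  rw [ENNReal.log_of_nnreal hN, EReal.real_coe_toENNReal]
  rcases le_total (N : ℝ) (Real.exp (-n)) with h | h
  · have h1 := Real.log_le_log hpos h
    rw [Real.log_exp] at h1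
    rw [max_eq_right h, Real.log_exp, ENNReal.ofReal_of_nonpos hn,
      ENNReal.ofReal_of_nonpos (h1.trans hn)]
  · rw [max_eq_left h]

/-- The same truncation caps the negative part of the logarithm at `n`; these caps increase to the
full negative part. -/
lemma ofReal_neg_log_max (N : ℝ≥0) (n : ℕ) :
    ENNReal.ofReal (-Real.log (max (N : ℝ) (Real.exp (-n)))) =
      min (-ENNReal.log N).toENNReal n := by
  obtain rfl | hN := eq_or_ne N 0
  · simp [(Real.exp_pos _).le]
  have hpos : (0 : ℝ) < N := by exact_mod_cast hN.bot_lt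
  rw [ENNReal.log_of_nnreal hN, ← EReal.coe_neg, EReal.real_coe_toENNReal,
    ← ENNReal.ofReal_natCast, ← ENNReal.ofReal_min]
  rcases le_total (N : ℝ) (Real.exp (-n)) with h | h
  · have h1 := Real.log_le_log hpos h
    rw [Real.log_exp] at h1
    rw [max_eq_right h, Real.log_exp, neg_neg, min_eq_right (by linarith)]
  · have h1 := Real.log_le_log (Real.exp_pos _) h
    rw [Real.log_exp] at h1
    rw [max_eq_left h, min_eq_left (by linarith)]

/-- The sub-mean value inequality for `log N`, in terms of extended real valued means. -/
lemma log_le_eRealCircleMean {N : ℂ → ℝ≥0} {z₀ : ℂ} {r : ℝ} (hr : 0 < r)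
    (hN : ContinuousOn N (sphere z₀ r))
    (h : ∀ p : ℂ → ℂ, Differentiable ℂ p →
      (∀ z ∈ sphere z₀ r, (N z : ℝ) ≤ Real.exp (p z).re) → (N z₀ : ℝ) ≤ Real.exp (p z₀).re) :
    ENNReal.log (N z₀) ≤ ERealCircleMean (fun z => ENNReal.log (N z)) z₀ r := by
  -- The truncations are continuous majorants of `log N`, to which the harmonic comparison applies
  -- even if `N` has zeros. Their positive parts have the common finite integral `a`, and monotone
  -- convergence handles the negative parts.
  set φ : ℕ → ℂ → ℝ := fun n z => Real.log (max (N z : ℝ) (Real.exp (-n))) with hφ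
  have hmaxpos : ∀ (n : ℕ) z, 0 < max (N z : ℝ) (Real.exp (-n)) := fun n z =>
    lt_max_of_lt_right (Real.exp_pos _)
  have hφc : ∀ n, ContinuousOn (φ n) (sphere z₀ r) := fun n =>
    ((NNReal.continuous_coe.comp_continuousOn hN).sup continuousOn_const).log
      fun z _ => (hmaxpos n z).ne'
  set γ : ℝ → ℂ := fun τ => circleMap z₀ r (2 * Real.pi * τ) with hγ
  have hγc : Continuous γ := (continuous_circleMap z₀ r).comp (by fun_prop)
  have hγs : ∀ τ, γ τ ∈ sphere z₀ r := fun τ => circleMap_mem_sphere _ hr.le _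
  have hNγ : Continuous fun τ => N (γ τ) := hN.comp_continuous hγc hγs
  have hφγ : ∀ n, Continuous fun τ => φ n (γ τ) := fun n => (hφc n).comp_continuous hγc hγs
  have hlog : Continuous fun τ => ENNReal.log (N (γ τ)) :=
    ENNReal.continuous_log.comp (ENNReal.continuous_coe.comp hNγ)
  set a : ℝ≥0∞ := ∫⁻ τ in Set.Ioc (0 : ℝ) 1, (ENNReal.log (N (γ τ))).toENNReal with ha
  set b : ℕ → ℝ≥0∞ := fun n => ∫⁻ τ in Set.Ioc (0 : ℝ) 1,
    min (-ENNReal.log (N (γ τ))).toENNReal n with hb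
  have hint : ∀ n, MeasureTheory.Integrable (fun τ => φ n (γ τ))
      (MeasureTheory.volume.restrict (Set.Ioc (0 : ℝ) 1)) := fun n =>
    (hφγ n).integrableOn_Ioc
  have hai : ∀ n, a = ∫⁻ τ in Set.Ioc (0 : ℝ) 1, ENNReal.ofReal (φ n (γ τ)) := fun n => by
    simp only [hφ, ofReal_log_max, ha]
  have hbi : ∀ n, b n = ∫⁻ τ in Set.Ioc (0 : ℝ) 1, ENNReal.ofReal (-φ n (γ τ)) := fun n => by
    simp only [hφ, ofReal_neg_log_max, hb]
  have hatop : a ≠ ⊤ := by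
    rw [hai 0]
    exact (hint 0).lintegral_lt_top.ne
  have hbtop : ∀ n, b n ≠ ⊤ := fun n => by
    rw [hbi n]
    exact (hint n).neg.lintegral_lt_top.ne
  have hbound : ∀ n, ENNReal.log (N z₀) ≤ (a : EReal) - (b n : EReal) := by
    intro n
    have h1 : (N z₀ : ℝ) ≤ Real.exp (Real.circleAverage (φ n) z₀ r + 0) := by
      refine le_exp_circleAverage (N := fun z => (N z : ℝ)) hr (by simpa using h) (hφc n)
        fun z _ => ?_
      rw [hφ, Real.exp_log (hmaxpos n z)]
      exact le_max_left _ _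
    rw [add_zero, circleAverage_eq_integral_Ioc,
      MeasureTheory.integral_eq_lintegral_pos_part_sub_lintegral_neg_part (hint n), ← hai n,
      ← hbi n] at h1
    have h2 : (N z₀ : ℝ≥0∞) ≤ ENNReal.ofReal (Real.exp (a.toReal - (b n).toReal)) := by
      rw [← ENNReal.ofReal_coe_nnreal]
      exact ENNReal.ofReal_le_ofReal h1
    refine (ENNReal.log_le_log h2).trans (le_of_eq ?_)
    rw [ENNReal.log_ofReal_of_pos (Real.exp_pos _), Real.log_exp, EReal.coe_sub,
      EReal.coe_ennreal_toReal hatop, EReal.coe_ennreal_toReal (hbtop n)]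
  have hbt : Filter.Tendsto b Filter.atTop
      (𝓝 (∫⁻ τ in Set.Ioc (0 : ℝ) 1, (-ENNReal.log (N (γ τ))).toENNReal)) := by
    have hm : Measurable fun τ => (-ENNReal.log (N (γ τ))).toENNReal :=
      (continuous_neg.comp hlog).ereal_toENNReal.measurable
    refine MeasureTheory.lintegral_tendsto_of_tendsto_of_monotone
      (fun n => (hm.min measurable_const).aemeasurable) (Filter.Eventually.of_forall fun τ => ?_)
      (Filter.Eventually.of_forall fun τ => ?_)
    · intro m n hmn
      exact min_le_min le_rfl (by exact_mod_cast hmn)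
    · have := (tendsto_const_nhds (x := (-ENNReal.log (N (γ τ))).toENNReal)
        (f := Filter.atTop (α := ℕ))).min ENNReal.tendsto_nat_nhds_top
      rwa [min_top_right] at this
  have hlim : Filter.Tendsto (fun n => (a : EReal) - (b n : EReal)) Filter.atTop
      (𝓝 (ERealCircleMean (fun z => ENNReal.log (N z)) z₀ r)) := by
    have h1 : Filter.Tendsto (fun n => -(b n : EReal)) Filter.atTop
        (𝓝 (-((∫⁻ τ in Set.Ioc (0 : ℝ) 1, (-ENNReal.log (N (γ τ))).toENNReal : ℝ≥0∞) : EReal))) :=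
      (continuous_neg.tendsto _).comp ((continuous_coe_ennreal_ereal.tendsto _).comp hbt)
    -- Finiteness of `a` rules out `⊤ - ⊤`, also when the negative part has infinite integral.
    exact (EReal.continuousAt_add (p := ((a : EReal), _)) (Or.inl (by simpa using hatop))
      (Or.inl (by simp))).tendsto.comp (tendsto_const_nhds.prodMk_nhds h1)
  exact ge_of_tendsto' hlim hbound

lemma coe_le_of_forall_pos_sub_le {c : ℝ} {x : EReal}
    (h : ∀ ε : ℝ, 0 < ε → ((c - ε : ℝ) : EReal) ≤ x) : (c : EReal) ≤ x := by
  refine le_of_forall_lt fun d hd => ?_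
  induction d with
  | bot => exact (EReal.bot_lt_coe _).trans_le (h 1 one_pos)
  | coe y =>
    rw [EReal.coe_lt_coe_iff] at hd
    refine lt_of_lt_of_le ?_ (h ((c - y) / 2) (by linarith))
    rw [EReal.coe_lt_coe_iff]
    linarith
  | top => exact absurd hd (by simp)

/-- If `N` is locally dominated by exponentials of harmonic functions up to `ε r²`, for all
`ε > 0`, then the generalized Levi form of `log N` is nonnegative. -/
lemma circleLevi_nonneg {N : ℂ → ℝ} {z₀ : ℂ} (hpos : 0 < N z₀)
    (hN : ∀ᶠ z in 𝓝 z₀, ContinuousAt N z)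
    (h : ∀ ε : ℝ, 0 < ε → ∀ᶠ r in 𝓝[>] (0 : ℝ), ∀ p : ℂ → ℂ, Differentiable ℂ p →
      (∀ z ∈ sphere z₀ r, N z ≤ Real.exp (p z).re) →
      N z₀ ≤ Real.exp ((p z₀).re + ε * r ^ 2)) :
    0 ≤ circleLevi (fun z => Real.log (N z)) z₀ := by
  have key : ∀ ε : ℝ, 0 < ε → ((-ε : ℝ) : EReal) ≤ circleLevi (fun z => Real.log (N z)) z₀ := by
    intro ε hε
    refine Filter.le_limsup_of_frequently_le (Filter.Eventually.frequently ?_)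
      (by isBoundedDefault)
    have hNpos : ∀ᶠ z in 𝓝 z₀, 0 < N z := hN.self_of_nhds.eventually (lt_mem_nhds hpos)
    have hr0 : ∀ᶠ r : ℝ in 𝓝[>] 0, 0 < r := eventually_mem_nhdsWithin
    filter_upwards [h ε hε, hr0, nhdsWithin_le_nhds (eventually_forall_mem_sphere (hN.and hNpos))]
      with r h1 hr h2
    rw [abs_of_pos hr] at h2
    rw [EReal.coe_le_coe_iff, le_div_iff₀ (by positivity)]
    -- On small circles `N` is positive, so `log N` is itself an admissible continuous majorant.
    have h3 := le_exp_circleAverage (φ := fun z => Real.log (N z)) hr h1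
      (fun z hz => ((h2 z hz).1.log (h2 z hz).2.ne').continuousWithinAt)
      fun z hz => (Real.exp_log (h2 z hz).2).ge
    have h4 := Real.log_le_log hpos h3
    rw [Real.log_exp] at h4
    linarith
  exact_mod_cast coe_le_of_forall_pos_sub_le (c := 0) fun ε hε => by simpa using key ε hε

end Subharmonic

/-! ### Second order calculus of circle averages. -/

section LeviCalculus

open Metric Filter Asymptotics

variable {E G : Type*} [NormedAddCommGroup E] [NormedSpace ℝ E] [NormedAddCommGroup G]
  [NormedSpace ℝ G]

/-- The second order Taylor formula `P (x₀ + x) = P x₀ + L x + B x x / 2 + o(‖x‖²)`, for a function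
that is continuous near `x₀`. -/
structure HasTaylorTwo (P : E → G) (x₀ : E) (L : E →L[ℝ] G) (B : E →L[ℝ] E →L[ℝ] G) : Prop where
  hasFDerivAt : HasFDerivAt P L x₀
  eventually_continuousAt : ∀ᶠ x in 𝓝 x₀, ContinuousAt P x
  isLittleO : (fun x => P x - P x₀ - L (x - x₀) - (1 / 2 : ℝ) • B (x - x₀) (x - x₀)) =o[𝓝 x₀]
    fun x => ‖x - x₀‖ ^ 2

/-- The Taylor remainder has derivative `P' y - P' x₀ - B (y - x₀)`, by symmetry of `B`. This is
`o(‖y - x₀‖)`, and the mean value inequality on the segment gains the second power. -/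
lemma HasTaylorTwo.of_hasFDerivAt {P : E → G} {x₀ : E} {P' : E → E →L[ℝ] G}
    {B : E →L[ℝ] E →L[ℝ] G} (h : ∀ᶠ x in 𝓝 x₀, HasFDerivAt P (P' x) x)
    (h' : HasFDerivAt P' B x₀) : HasTaylorTwo P x₀ (P' x₀) B := by
  refine ⟨h.self_of_nhds, h.mono fun x hx => hx.continuousAt, ?_⟩
  have hsymm : ∀ v w, B v w = B w v := fun v w =>
    second_derivative_symmetric_of_eventually h h' v w
  rw [isLittleO_iff]
  intro c hc
  have h2 := h'.isLittleO
  rw [isLittleO_iff] at h2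
  obtain ⟨δ, hδ, hball⟩ := Metric.eventually_nhds_iff_ball.1 (h.and (h2 hc))
  filter_upwards [ball_mem_nhds x₀ hδ] with x hx
  set R : E → G := fun x => P x - P x₀ - P' x₀ (x - x₀) - (1 / 2 : ℝ) • B (x - x₀) (x - x₀) with hR
  have hRd : ∀ y ∈ ball x₀ δ, HasFDerivAt R (P' y - P' x₀ - B (y - x₀)) y := by
    intro y hy
    have e1 : HasFDerivAt (fun y => B (y - x₀) (y - x₀)) ((2 : ℝ) • B (y - x₀)) y := by
      have a1 : HasFDerivAt (fun y => y - x₀) (ContinuousLinearMap.id ℝ E) y :=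
        (hasFDerivAt_id y).sub_const x₀
      have a2 := (B.hasFDerivAt.comp y a1).clm_apply a1
      refine a2.congr_fderiv ?_
      ext v
      simp [hsymm v, two_smul]
    have e2 := (((hball y hy).1.sub_const (P x₀)).sub
      ((P' x₀).hasFDerivAt.comp y ((hasFDerivAt_id y).sub_const x₀))).sub
      (e1.const_smul (1 / 2 : ℝ))
    refine e2.congr_fderiv ?_
    ext v
    simp [smul_smul]
  have hseg : segment ℝ x₀ x ⊆ ball x₀ δ :=
    (convex_ball x₀ δ).segment_subset (mem_ball_self hδ) hx
  have hmv := (convex_segment x₀ x).norm_image_sub_le_of_norm_hasFDerivWithin_le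
    (f := R) (f' := fun y => P' y - P' x₀ - B (y - x₀)) (C := c * ‖x - x₀‖)
    (fun y hy => (hRd y (hseg hy)).hasFDerivWithinAt)
    (fun y hy => ((hball y (hseg hy)).2).trans (by
      gcongr
      simpa [dist_eq_norm] using
        (convex_closedBall x₀ ‖x - x₀‖).segment_subset (mem_closedBall_self (norm_nonneg _))
        (by simp [dist_eq_norm]) hy))
    (left_mem_segment ℝ x₀ x) (right_mem_segment ℝ x₀ x)
  have hR0 : R x₀ = 0 := by simp [hR]
  rw [hR0, sub_zero] at hmv
  rw [norm_pow, norm_norm]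
  calc _ ≤ _ := hmv
    _ = _ := by ring

lemma ContDiffAt.hasTaylorTwo {P : E → G} {x₀ : E} (h : ContDiffAt ℝ 2 P x₀) :
    HasTaylorTwo P x₀ (fderiv ℝ P x₀) (fderiv ℝ (fderiv ℝ P) x₀) := by
  refine HasTaylorTwo.of_hasFDerivAt (P' := fderiv ℝ P) ?_ ?_
  · filter_upwards [h.eventually (by simp)] with x hx
    exact (hx.differentiableAt (by simp)).hasFDerivAt
  · exact ((h.fderiv_right (m := 1) (by norm_num)).differentiableAt (by simp)).hasFDerivAt

lemma ContinuousLinearMap.hasTaylorTwo (L : E →L[ℝ] G) (x₀ : E) : HasTaylorTwo L x₀ L 0 := by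
  refine ⟨L.hasFDerivAt, Eventually.of_forall fun x => L.continuous.continuousAt,
    (isLittleO_zero _ _).congr_left fun x => ?_⟩
  simp

/-- A bounded bilinear map equals its second order Taylor polynomial, so the remainder vanishes
identically. -/
lemma ContinuousLinearMap.hasTaylorTwo_bilinear {F : Type*} [NormedAddCommGroup F]
    [NormedSpace ℝ F] (b : E →L[ℝ] F →L[ℝ] G) (p : E × F) :
    HasTaylorTwo (fun q : E × F => b q.1 q.2) p (b.deriv₂ p) b.deriv₂ := by
  refine ⟨b.hasFDerivAt_of_bilinear hasFDerivAt_fst hasFDerivAt_snd |>.congr_fderiv ?_,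
    Eventually.of_forall fun q => ?_, ?_⟩
  · ext <;> simp
  · exact ((b.continuous.comp continuous_fst).clm_apply continuous_snd).continuousAt
  · refine (isLittleO_zero _ _).congr_left fun q => ?_
    simp only [ContinuousLinearMap.coe_deriv₂, map_sub, sub_apply]
    module

/-- The circle averages of `F` satisfy `∫₀¹ F (r e^{2πiτ}) dτ = F 0 + k r² + o(r²)`; moreover `F` is
continuous near `0`, and differentiable at `0` with derivative `D`. -/
structure HasLevi (F : ℂ → E) (D : ℂ →L[ℝ] E) (k : E) : Prop where
  hasFDerivAt : HasFDerivAt F D 0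
  eventually_continuousAt : ∀ᶠ z in 𝓝 (0 : ℂ), ContinuousAt F z
  tendsto : Tendsto (fun r : ℝ => (r ^ 2)⁻¹ • (Real.circleAverage F 0 r - F 0)) (𝓝[>] 0) (𝓝 k)

lemma norm_circleAverage_le {F : ℂ → E} {z : ℂ} {r C : ℝ}
    (h : ∀ ζ ∈ sphere z |r|, ‖F ζ‖ ≤ C) : ‖Real.circleAverage F z r‖ ≤ C := by
  rw [Real.circleAverage, norm_smul]
  have := intervalIntegral.norm_integral_le_of_norm_le_const (a := 0) (b := 2 * Real.pi)
    (f := fun θ => F (circleMap z r θ)) (C := C) fun θ _ => h _ (circleMap_mem_sphere' z r θ)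
  rw [sub_zero, abs_of_pos Real.two_pi_pos] at this
  rw [norm_inv, Real.norm_of_nonneg Real.two_pi_pos.le, inv_mul_le_iff₀ Real.two_pi_pos]
  linarith

lemma tendsto_circleAverage_of_isLittleO {F : ℂ → E} (h : F =o[𝓝 0] fun z => ‖z‖ ^ 2) :
    Tendsto (fun r : ℝ => (r ^ 2)⁻¹ • Real.circleAverage F 0 r) (𝓝[>] 0) (𝓝 0) := by
  rw [Metric.tendsto_nhds]
  intro ε hε
  have hr : ∀ᶠ r : ℝ in 𝓝[>] 0, 0 < r := eventually_mem_nhdsWithin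
  filter_upwards [hr, nhdsWithin_le_nhds
    (eventually_forall_mem_sphere (isLittleO_iff.1 h (half_pos hε)))] with r hr h1
  have h2 : ‖Real.circleAverage F 0 r‖ ≤ ε / 2 * r ^ 2 := by
    refine norm_circleAverage_le fun ζ hζ => (h1 ζ hζ).trans (le_of_eq ?_)
    rw [mem_sphere, dist_zero_right, abs_of_pos hr] at hζ
    rw [norm_pow, norm_norm, hζ]
  rw [dist_zero_right, norm_smul, norm_inv, norm_pow, Real.norm_of_nonneg hr.le,
    inv_mul_lt_iff₀ (by positivity)]
  nlinarith [pow_pos hr 2]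

/-- A real quadratic form on `ℂ` is a multiple of `‖z‖²` plus a real linear function of `z²`, and
the latter has mean zero on circles about `0`. -/
lemma circleAverage_bilinear [CompleteSpace E] (B : ℂ →L[ℝ] ℂ →L[ℝ] E) (r : ℝ) :
    Real.circleAverage (fun z => B z z) 0 r =
      (r ^ 2) • ((1 / 2 : ℝ) • (B 1 1 + B Complex.I Complex.I)) := by
  set m := (1 / 2 : ℝ) • (B 1 1 + B Complex.I Complex.I) with hm
  set L : ℂ →L[ℝ] E :=
    Complex.reCLM.smulRight ((1 / 2 : ℝ) • (B 1 1 - B Complex.I Complex.I)) +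
    Complex.imCLM.smulRight ((1 / 2 : ℝ) • (B 1 Complex.I + B Complex.I 1)) with hL
  have h1 : ∀ z, B z z = (‖z‖ ^ 2) • m + L (z ^ 2) := by
    intro z
    have e : z = z.re • (1 : ℂ) + z.im • Complex.I := by
      simp
    have e2 : ‖z‖ ^ 2 = z.re ^ 2 + z.im ^ 2 := by
      rw [← Complex.normSq_eq_norm_sq, Complex.normSq_apply]; ring
    have e3 : (z ^ 2).re = z.re ^ 2 - z.im ^ 2 := by simp [sq]
    have e4 : (z ^ 2).im = 2 * (z.re * z.im) := by simp [sq]; ring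
    have e5 : B z z = z.re • z.re • B 1 1 + z.re • z.im • B 1 Complex.I +
        z.im • z.re • B Complex.I 1 + z.im • z.im • B Complex.I Complex.I := by
      conv_lhs => rw [e]
      simp only [map_add, map_smul, add_apply, smul_apply,
        smul_add]
      module
    rw [e5, e2]
    simp only [hL, hm, add_apply, ContinuousLinearMap.smulRight_apply,
      Complex.reCLM_apply, Complex.imCLM_apply, e3, e4]
    module
  have h2 : Real.circleAverage (fun z => B z z) 0 r =
      Real.circleAverage (fun z => (r ^ 2) • m + L (z ^ 2)) 0 r := by
    refine Real.circleAverage_congr_sphere fun z hz => ?_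
    rw [mem_sphere, dist_zero_right] at hz
    rw [h1 z, hz, sq_abs]
  have h3 : Real.circleAverage (fun z : ℂ => L (z ^ 2)) 0 r = 0 := by
    have a := L.circleAverage_comp_comm (f := fun z : ℂ => z ^ 2) (c := 0) (R := r)
      (by exact ContinuousOn.circleIntegrable' (Continuous.continuousOn (by fun_prop)))
    have b : Real.circleAverage (fun z : ℂ => z ^ 2) 0 r = 0 := by
      rw [DiffContOnCl.circleAverage (Differentiable.diffContOnCl (by fun_prop))]
      simp
    rw [b, map_zero] at a
    exact a
  rw [h2, Real.circleAverage_fun_add (ContinuousOn.circleIntegrable' continuousOn_const)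
    (ContinuousOn.circleIntegrable' (Continuous.continuousOn (by fun_prop))), h3,
    Real.circleAverage_const, add_zero]

variable [CompleteSpace E] [CompleteSpace G]

/-- The linear Taylor term of `P` transports `k`. The quadratic one may be evaluated on `D z`, since
`F z - F 0 - D z = o(z)`, and its average gives the factor `1/4`: one half from Taylor, one half
from `circleAverage_bilinear`. -/
lemma HasLevi.comp {F : ℂ → E} {D : ℂ →L[ℝ] E} {k : E} (hF : HasLevi F D k) {P : E → G}
    {L : E →L[ℝ] G} {B : E →L[ℝ] E →L[ℝ] G} (hP : HasTaylorTwo P (F 0) L B) :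
    HasLevi (fun z => P (F z)) (L ∘L D)
      (L k + (1 / 4 : ℝ) • (B (D 1) (D 1) + B (D Complex.I) (D Complex.I))) := by
  have hF0 : ContinuousAt F 0 := hF.eventually_continuousAt.self_of_nhds
  have hc : ∀ᶠ z in 𝓝 (0 : ℂ), ContinuousAt (fun z => P (F z)) z := by
    filter_upwards [hF.eventually_continuousAt, hF0.eventually hP.eventually_continuousAt]
      with z h1 h2
    exact ContinuousAt.comp (g := P) h2 h1
  refine ⟨hP.hasFDerivAt.comp 0 hF.hasFDerivAt, hc, ?_⟩
  have hO : (fun z => F z - F 0) =O[𝓝 0] fun z => z := by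
    simpa using hF.hasFDerivAt.isBigO_sub
  have ho : (fun z => F z - F 0 - D z) =o[𝓝 0] fun z => z := by
    simpa using hF.hasFDerivAt.isLittleO
  have hDO : (fun z => D z) =O[𝓝 0] fun z => z := D.isBigO_id _
  set R1 : ℂ → G := fun z => P (F z) - P (F 0) - L (F z - F 0) -
    (1 / 2 : ℝ) • B (F z - F 0) (F z - F 0) with hR1
  have h1 : R1 =o[𝓝 0] fun z : ℂ => ‖z‖ ^ 2 :=
    (hP.isLittleO.comp_tendsto hF0).trans_isBigO (hO.norm_norm.pow 2)
  have hB : ∀ {u v : ℂ → E} , u =o[𝓝 0] (fun z : ℂ => z) → v =O[𝓝 0] (fun z : ℂ => z) →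
      (fun z => B (u z) (v z)) =o[𝓝 0] (fun z : ℂ => ‖z‖ ^ 2) ∧
      (fun z => B (v z) (u z)) =o[𝓝 0] (fun z : ℂ => ‖z‖ ^ 2) := by
    intro u v hu hv
    constructor
    · refine (IsBigO.of_bound ‖B‖ (Eventually.of_forall fun z => ?_)).trans_isLittleO
        ((hu.norm_norm.mul_isBigO hv.norm_norm).congr_right fun z => (sq _).symm)
      rw [norm_mul, norm_norm, norm_norm, ← mul_assoc]
      exact B.le_opNorm₂ _ _
    · refine (IsBigO.of_bound ‖B‖ (Eventually.of_forall fun z => ?_)).trans_isLittleO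
        ((hu.norm_norm.mul_isBigO hv.norm_norm).congr_right fun z => (sq _).symm)
      rw [norm_mul, norm_norm, norm_norm, mul_comm ‖u z‖, ← mul_assoc]
      exact B.le_opNorm₂ _ _
  have h2 : (fun z => B (F z - F 0) (F z - F 0) - B (D z) (D z)) =o[𝓝 0]
      fun z : ℂ => ‖z‖ ^ 2 := by
    refine ((hB ho hO).1.add (hB ho hDO).2).congr_left fun z => ?_
    simp only [map_sub, sub_apply]
    abel
  set B' : ℂ →L[ℝ] ℂ →L[ℝ] G := B.bilinearComp D D with hB'
  have hB'' : ∀ z w, B' z w = B (D z) (D w) := fun z w => rfl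
  set R : ℂ → G := fun z => P (F z) - P (F 0) - L (F z - F 0) - (1 / 2 : ℝ) • B' z z with hR
  have hRo : R =o[𝓝 0] fun z : ℂ => ‖z‖ ^ 2 := by
    refine (h1.add (h2.const_smul_left (1 / 2 : ℝ))).congr_left fun z => ?_
    simp only [hR, hR1, hB'', Pi.smul_apply, smul_sub]
    abel
  have hlim := (tendsto_circleAverage_of_isLittleO hRo).add
    (((L.continuous.tendsto _).comp hF.tendsto).add
      (tendsto_const_nhds (x := (1 / 4 : ℝ) • (B' 1 1 + B' Complex.I Complex.I))))
  rw [zero_add] at hlim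
  refine hlim.congr' ?_
  have hr : ∀ᶠ r : ℝ in 𝓝[>] 0, 0 < r := eventually_mem_nhdsWithin
  filter_upwards [hr, nhdsWithin_le_nhds (circleIntegrable_of_eventually_continuousAt hc),
    nhdsWithin_le_nhds (circleIntegrable_of_eventually_continuousAt hF.eventually_continuousAt)]
    with r hr i1 i2
  have iB : CircleIntegrable (fun z => (1 / 2 : ℝ) • B' z z) 0 r :=
    ContinuousOn.circleIntegrable' (Continuous.continuousOn (by fun_prop))
  have iF : CircleIntegrable (fun z => F z - F 0) 0 r :=
    i2.sub (ContinuousOn.circleIntegrable' continuousOn_const)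
  have iL : CircleIntegrable (fun z => L (F z - F 0)) 0 r :=
    ⟨L.integrable_comp iF.1, L.integrable_comp iF.2⟩
  have iP : CircleIntegrable (fun z => P (F z) - P (F 0)) 0 r :=
    i1.sub (ContinuousOn.circleIntegrable' continuousOn_const)
  have eL : Real.circleAverage (fun z => L (F z - F 0)) 0 r =
      L (Real.circleAverage F 0 r - F 0) := by
    have := L.circleAverage_comp_comm iF
    rw [Real.circleAverage_fun_sub i2 (ContinuousOn.circleIntegrable' continuousOn_const),
      Real.circleAverage_const] at this
    exact this
  have eR : Real.circleAverage R 0 r = Real.circleAverage (fun z => P (F z)) 0 r - P (F 0) -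
      L (Real.circleAverage F 0 r - F 0) -
      (1 / 2 : ℝ) • (r ^ 2) • ((1 / 2 : ℝ) • (B' 1 1 + B' Complex.I Complex.I)) := by
    rw [hR, Real.circleAverage_fun_sub (f₁ := fun z => P (F z) - P (F 0) - L (F z - F 0))
      (iP.sub iL) iB, Real.circleAverage_fun_sub iP iL,
      Real.circleAverage_fun_sub i1 (ContinuousOn.circleIntegrable' continuousOn_const),
      Real.circleAverage_const, eL, Real.circleAverage_fun_smul, circleAverage_bilinear]
  rw [eR, Function.comp_apply, map_smul]
  have : (r ^ 2)⁻¹ * r ^ 2 = 1 := inv_mul_cancel₀ (by positivity)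
  match_scalars <;> field_simp <;> ring

lemma HasLevi.prodMk {F : ℂ → E} {D : ℂ →L[ℝ] E} {k : E} (hF : HasLevi F D k) {F' : ℂ → G}
    {D' : ℂ →L[ℝ] G} {k' : G} (hF' : HasLevi F' D' k') :
    HasLevi (fun z => (F z, F' z)) (D.prod D') (k, k') := by
  have hc : ∀ᶠ z in 𝓝 (0 : ℂ), ContinuousAt (fun z => (F z, F' z)) z := by
    filter_upwards [hF.eventually_continuousAt, hF'.eventually_continuousAt] with z h1 h2
    exact h1.prodMk h2
  refine ⟨hF.hasFDerivAt.prodMk hF'.hasFDerivAt, hc, ?_⟩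
  refine (hF.tendsto.prodMk_nhds hF'.tendsto).congr' ?_
  filter_upwards [nhdsWithin_le_nhds (circleIntegrable_of_eventually_continuousAt hc)] with r hr
  have h1 : Real.circleAverage F 0 r = (Real.circleAverage (fun z => (F z, F' z)) 0 r).1 :=
    (ContinuousLinearMap.fst ℝ E G).circleAverage_comp_comm hr
  have h2 : Real.circleAverage F' 0 r = (Real.circleAverage (fun z => (F z, F' z)) 0 r).2 :=
    (ContinuousLinearMap.snd ℝ E G).circleAverage_comp_comm hr
  ext
  · simp [h1]
  · simp [h2]

lemma HasLevi.bilinear {H : Type*} [NormedAddCommGroup H] [NormedSpace ℝ H] [CompleteSpace H]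
    {F : ℂ → E} {D : ℂ →L[ℝ] E} {k : E} (hF : HasLevi F D k) {F' : ℂ → G}
    {D' : ℂ →L[ℝ] G} {k' : G} (hF' : HasLevi F' D' k') (b : E →L[ℝ] G →L[ℝ] H) :
    HasLevi (fun z => b (F z) (F' z)) (b.deriv₂ (F 0, F' 0) ∘L D.prod D')
      (b (F 0) k' + b k (F' 0) +
        (1 / 2 : ℝ) • (b (D 1) (D' 1) + b (D Complex.I) (D' Complex.I))) := by
  have := (hF.prodMk hF').comp (b.hasTaylorTwo_bilinear (F 0, F' 0))
  convert this using 1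
  simp only [ContinuousLinearMap.coe_deriv₂, ContinuousLinearMap.prod_apply]
  module

/-- The mean value property makes the second order term zero. Consequently, for compositions with a
holomorphic curve, only the first derivative of the curve matters. -/
lemma HasLevi.of_differentiable {E : Type*} [NormedAddCommGroup E] [NormedSpace ℂ E]
    [CompleteSpace E] {F : ℂ → E} (h : ∀ᶠ z in 𝓝 (0 : ℂ), DifferentiableAt ℂ F z) :
    HasLevi F ((fderiv ℂ F 0).restrictScalars ℝ) 0 := by
  refine ⟨h.self_of_nhds.hasFDerivAt.restrictScalars ℝ, h.mono fun z hz => hz.continuousAt,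
    tendsto_const_nhds.congr' ?_⟩
  obtain ⟨δ, hδ, hball⟩ := Metric.eventually_nhds_iff_ball.1 h
  filter_upwards [nhdsWithin_le_nhds (ball_mem_nhds (0 : ℝ) hδ)] with r hr
  rw [mem_ball_zero_iff, Real.norm_eq_abs] at hr
  have : DiffContOnCl ℂ F (ball 0 |r|) := by
    refine DifferentiableOn.diffContOnCl fun z hz => (hball z ?_).differentiableWithinAt
    exact lt_of_le_of_lt (closure_ball_subset_closedBall hz) hr
  rw [this.circleAverage, sub_self, smul_zero]

lemma HasLevi.const_mul {F : ℂ → ℝ} {D : ℂ →L[ℝ] ℝ} {k : ℝ} (hF : HasLevi F D k) (c : ℝ) :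
    HasLevi (fun z => c * F z) (c • D) (c * k) := by
  have := hF.comp ((ContinuousLinearMap.mul ℝ ℝ c).hasTaylorTwo (F 0))
  convert this using 1
  · simp
  · ext
    simp
  · simp

lemma HasLevi.log {F : ℂ → ℝ} {D : ℂ →L[ℝ] ℝ} {k : ℝ} (hF : HasLevi F D k) (h0 : F 0 ≠ 0) :
    HasLevi (fun z => Real.log (F z)) ((F 0)⁻¹ • D)
      (k / F 0 - ((D 1) ^ 2 + (D Complex.I) ^ 2) / (4 * (F 0) ^ 2)) := by
  have h1 : ∀ᶠ x in 𝓝 (F 0), HasFDerivAt Real.log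
      ((1 : ℝ →L[ℝ] ℝ).smulRight x⁻¹) x := by
    filter_upwards [eventually_ne_nhds h0] with x hx
    exact (Real.hasDerivAt_log hx).hasFDerivAt
  have h2 : HasFDerivAt (fun x : ℝ => (1 : ℝ →L[ℝ] ℝ).smulRight x⁻¹)
      ((ContinuousLinearMap.smulRightL ℝ ℝ ℝ 1) ∘L
        ((1 : ℝ →L[ℝ] ℝ).smulRight (-((F 0) ^ 2)⁻¹))) (F 0) :=
    (ContinuousLinearMap.smulRightL ℝ ℝ ℝ 1).hasFDerivAt.comp (F 0)
      (hasDerivAt_inv h0).hasFDerivAt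
  have := hF.comp (HasTaylorTwo.of_hasFDerivAt h1 h2)
  convert this using 1
  · ext
    simp [mul_comm]
  · simp
    field_simp
    ring

lemma HasLevi.circleLevi_eq {F : ℂ → ℝ} {D : ℂ →L[ℝ] ℝ} {k : ℝ} (hF : HasLevi F D k) :
    circleLevi F 0 = k := by
  refine Tendsto.limsup_eq ((continuous_coe_real_ereal.tendsto k).comp (hF.tendsto.congr fun r => ?_))
  rw [smul_eq_mul, div_eq_inv_mul]

end LeviCalculus

/-! ### Positive operators and the Levi form of `log ⟨Q y, y⟩`. -/

section GramOperator

open Filter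

variable {W : Type*} [NormedAddCommGroup W] [InnerProductSpace ℂ W]

/-- Application of a bounded operator to a vector, as a bounded real bilinear map. -/
def realApply (W : Type*) [NormedAddCommGroup W] [InnerProductSpace ℂ W] :
    (W →L[ℂ] W) →L[ℝ] W →L[ℝ] W :=
  LinearMap.mkContinuous₂ (LinearMap.mk₂ ℝ (fun (T : W →L[ℂ] W) w => T w)
    (fun _ _ _ => rfl) (fun _ _ _ => rfl) (fun T => T.map_add)
    (fun c T w => by exact (T.restrictScalars ℝ).map_smul c w)) 1
    fun T w => by rw [one_mul]; exact T.le_opNorm w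

/-- The real part of the inner product, as a bounded real bilinear map. -/
def realInner (W : Type*) [NormedAddCommGroup W] [InnerProductSpace ℂ W] :
    W →L[ℝ] W →L[ℝ] ℝ :=
  LinearMap.mkContinuous₂ (LinearMap.mk₂ ℝ (fun v w : W => (inner ℂ v w).re)
    (fun _ _ _ => by rw [inner_add_left, Complex.add_re])
    (fun c v w => by
      rw [← Complex.coe_smul, inner_smul_left, Complex.conj_ofReal, Complex.re_ofReal_mul,
        smul_eq_mul])
    (fun _ _ _ => by rw [inner_add_right, Complex.add_re])
    (fun c v w => by
      rw [← Complex.coe_smul, inner_smul_right, Complex.re_ofReal_mul, smul_eq_mul])) 1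
    fun v w => by
      simpa using (Complex.abs_re_le_norm _).trans (norm_inner_le_norm (𝕜 := ℂ) v w)

@[simp] lemma realApply_apply (T : W →L[ℂ] W) (w : W) : realApply W T w = T w := rfl

@[simp] lemma realInner_apply (v w : W) : realInner W v w = (inner ℂ v w).re := rfl

variable [CompleteSpace W]

lemma IsSelfAdjoint.inner_apply_left {P : W →L[ℂ] W} (hP : IsSelfAdjoint P) (x y : W) :
    inner ℂ (P x) y = inner ℂ x (P y) := by
  conv_rhs => rw [← hP.adjoint_eq]
  exact (ContinuousLinearMap.adjoint_inner_right P x y).symm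

/-- Cauchy–Schwarz for the hermitian form defined by `P`. -/
lemma IsSelfAdjoint.norm_inner_apply_sq_le {P : W →L[ℂ] W} (hP : IsSelfAdjoint P)
    (hpos : ∀ w : W, w ≠ 0 → 0 < (inner ℂ w (P w)).re) (v w : W) :
    ‖inner ℂ v (P w)‖ ^ 2 ≤ (inner ℂ v (P v)).re * (inner ℂ w (P w)).re := by
  let c : PreInnerProductSpace.Core ℂ W :=
    { inner := fun x y => inner ℂ x (P y)
      conj_inner_symm := fun x y => by rw [inner_conj_symm, hP.inner_apply_left]
      re_inner_nonneg := fun x => by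
        by_cases hx : x = 0
        · simp [hx]
        · exact (hpos x hx).le
      add_left := fun x y z => inner_add_left _ _ _
      smul_left := fun x y r => inner_smul_left _ _ _ }
  have h := @InnerProductSpace.Core.inner_mul_inner_self_le ℂ W _ _ _ c v w
  have h2 : ‖inner ℂ v (P w)‖ = ‖inner ℂ w (P v)‖ := by
    rw [← norm_inner_symm, hP.inner_apply_left]
  calc ‖inner ℂ v (P w)‖ ^ 2 = ‖inner ℂ v (P w)‖ * ‖inner ℂ w (P v)‖ := by rw [← h2, sq]
    _ ≤ _ := h

/-- Cauchy–Schwarz for `P`, applied to `P w` and `w`, bounds `‖P w‖²` by a multiple of `⟨P w, w⟩`,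
while invertibility bounds `‖w‖` by a multiple of `‖P w‖`. In infinite dimensions positivity alone
would not suffice. -/
lemma IsSelfAdjoint.exists_coercive {P : W →L[ℂ] W} (hP : IsSelfAdjoint P) (hu : IsUnit P)
    (hpos : ∀ w : W, w ≠ 0 → 0 < (inner ℂ w (P w)).re) :
    ∃ c : ℝ, 0 < c ∧ ∀ w : W, c * ‖w‖ ^ 2 ≤ (inner ℂ w (P w)).re := by
  obtain ⟨Q, hQ⟩ := hu.exists_left_inv
  set c := (‖P‖ + 1) * (‖Q‖ + 1) ^ 2 with hc
  have hcpos : 0 < c := by positivity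
  refine ⟨c⁻¹, inv_pos.2 hcpos, fun w => ?_⟩
  rw [inv_mul_le_iff₀ hcpos]
  have hQw : Q (P w) = w := by
    have := congrArg (fun T : W →L[ℂ] W => T w) hQ
    simpa using this
  have h1 : ‖w‖ ≤ (‖Q‖ + 1) * ‖P w‖ := by
    calc ‖w‖ = ‖Q (P w)‖ := by rw [hQw]
      _ ≤ ‖Q‖ * ‖P w‖ := Q.le_opNorm _
      _ ≤ _ := by gcongr; linarith
  set H := (inner ℂ w (P w)).re with hH
  have hH0 : 0 ≤ H := by
    by_cases hw : w = 0
    · simp [hH, hw]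
    · exact (hpos w hw).le
  have h2 : ‖P w‖ ^ 2 ≤ (‖P‖ + 1) * H := by
    have a := hP.norm_inner_apply_sq_le hpos (P w) w
    have b : ‖inner ℂ (P w) (P w)‖ = ‖P w‖ ^ 2 := by
      rw [inner_self_eq_norm_sq_to_K]; simp
    have d : (inner ℂ (P w) (P (P w))).re ≤ (‖P‖ + 1) * ‖P w‖ ^ 2 := by
      calc _ ≤ ‖inner ℂ (P w) (P (P w))‖ := Complex.re_le_norm _
        _ ≤ ‖P w‖ * ‖P (P w)‖ := norm_inner_le_norm _ _
        _ ≤ ‖P w‖ * ((‖P‖ + 1) * ‖P w‖) := by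
            gcongr
            refine (P.le_opNorm _).trans ?_
            gcongr
            linarith
        _ = _ := by ring
    rw [b] at a
    by_cases h0 : ‖P w‖ = 0
    · rw [h0]
      have : 0 ≤ (‖P‖ + 1) * H := by positivity
      simpa using this
    · have h0' : 0 < ‖P w‖ ^ 2 := by positivity
      have : ‖P w‖ ^ 2 * ‖P w‖ ^ 2 ≤ ((‖P‖ + 1) * H) * ‖P w‖ ^ 2 := by
        calc _ = (‖P w‖ ^ 2) ^ 2 := by ring
          _ ≤ _ := a
          _ ≤ ((‖P‖ + 1) * ‖P w‖ ^ 2) * H := by gcongr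
          _ = _ := by ring
      exact le_of_mul_le_mul_right this h0'
  calc ‖w‖ ^ 2 ≤ ((‖Q‖ + 1) * ‖P w‖) ^ 2 := by gcongr
    _ = (‖Q‖ + 1) ^ 2 * ‖P w‖ ^ 2 := by ring
    _ ≤ (‖Q‖ + 1) ^ 2 * ((‖P‖ + 1) * H) := by gcongr
    _ = c * H := by rw [hc]; ring

/-- Completing the square: `D₁`, `D₂` are the real partial derivatives of the Gram operator and `P
a` is its `∂`-derivative applied to `w`, so the terms containing `τ` combine to the squared `P`-norm
of `τ + a` minus that of `a`. -/
lemma re_inner_bracket {P D₁ D₂ : W →L[ℂ] W} (hP : IsSelfAdjoint P) (h₁ : IsSelfAdjoint D₁)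
    (h₂ : IsSelfAdjoint D₂) {w τ a : W}
    (ha : P a = (1 / 2 : ℂ) • (D₁ w - Complex.I • D₂ w)) :
    (1 / 2 : ℝ) * (inner ℂ w (D₁ τ + D₂ (Complex.I • τ))).re +
      (1 / 2 : ℝ) * ((inner ℂ τ (P τ + D₁ w)).re +
        (inner ℂ (Complex.I • τ) (P (Complex.I • τ) + D₂ w)).re) =
      (inner ℂ (τ + a) (P (τ + a))).re - (inner ℂ a (P a)).re := by
  have e1 : (inner ℂ w (D₁ τ)).re = (inner ℂ τ (D₁ w)).re := by
    rw [← h₁.inner_apply_left, ← inner_conj_symm, Complex.conj_re]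
  have e2 : (inner ℂ w (D₂ (Complex.I • τ))).re = (inner ℂ (Complex.I • τ) (D₂ w)).re := by
    rw [← h₂.inner_apply_left, ← inner_conj_symm, Complex.conj_re]
  have e3 : (inner ℂ a (P τ)).re = (inner ℂ τ (P a)).re := by
    rw [← hP.inner_apply_left, ← inner_conj_symm, Complex.conj_re]
  have e4 : 2 * (inner ℂ τ (P a)).re =
      (inner ℂ τ (D₁ w)).re + (inner ℂ (Complex.I • τ) (D₂ w)).re := by
    rw [ha, inner_smul_right, inner_sub_right, inner_smul_right, inner_smul_left]
    simp
  have e5 : (inner ℂ (Complex.I • τ) (P (Complex.I • τ))).re = (inner ℂ τ (P τ)).re := by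
    rw [map_smul, inner_smul_left, inner_smul_right, ← mul_assoc]
    simp
  simp only [map_add, inner_add_left, inner_add_right, Complex.add_re, e5]
  rw [e3, e1, e2]
  linarith

/-- This is `|dH|² = 4 |∂H|²` for the real function `H = ⟨Q y, y⟩`, where `∂H` is the `P`-product of
`τ + a` and `w`. Self-adjointness of `D₁`, `D₂` makes `⟨D₁ w, w⟩` and `⟨D₂ w, w⟩` real. -/
lemma sq_add_sq_re_inner {P D₁ D₂ : W →L[ℂ] W} (hP : IsSelfAdjoint P) (h₁ : IsSelfAdjoint D₁)
    (h₂ : IsSelfAdjoint D₂) {w τ a : W}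
    (ha : P a = (1 / 2 : ℂ) • (D₁ w - Complex.I • D₂ w)) :
    ((inner ℂ w (P τ + D₁ w)).re + (inner ℂ τ (P w)).re) ^ 2 +
      ((inner ℂ w (P (Complex.I • τ) + D₂ w)).re + (inner ℂ (Complex.I • τ) (P w)).re) ^ 2 =
      4 * ‖inner ℂ w (P (τ + a))‖ ^ 2 := by
  have e1 : (inner ℂ τ (P w)).re = (inner ℂ w (P τ)).re := by
    rw [← hP.inner_apply_left, ← inner_conj_symm, Complex.conj_re]
  have e2 : (inner ℂ (Complex.I • τ) (P w)).re = (inner ℂ w (P (Complex.I • τ))).re := by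
    rw [← hP.inner_apply_left, ← inner_conj_symm, Complex.conj_re]
  have i1 : (inner ℂ w (D₁ w)).im = 0 := by
    have := inner_conj_symm (𝕜 := ℂ) w (D₁ w)
    rw [h₁.inner_apply_left, Complex.conj_eq_iff_im] at this
    exact this
  have i2 : (inner ℂ w (D₂ w)).im = 0 := by
    have := inner_conj_symm (𝕜 := ℂ) w (D₂ w)
    rw [h₂.inner_apply_left, Complex.conj_eq_iff_im] at this
    exact this
  rw [e1, e2, map_add, ha, ← Complex.normSq_eq_norm_sq, Complex.normSq_apply]
  simp only [inner_add_right, inner_smul_right, inner_sub_right, map_smul]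
  simp [i1, i2]
  ring

/-- For a holomorphic curve `y` in `W` and a curve `Q` of operators, the generalized Levi form of
`log ⟨Q y, y⟩ / 2`. -/
lemma HasLevi.log_gram {Q : ℂ → W →L[ℂ] W} {D : ℂ →L[ℝ] W →L[ℂ] W} {K : W →L[ℂ] W}
    (hQ : HasLevi Q D K) {y : ℂ → W} (hy : ∀ᶠ z in 𝓝 (0 : ℂ), DifferentiableAt ℂ y z)
    (hsa : IsSelfAdjoint (Q 0)) (h1 : IsSelfAdjoint (D 1)) (hI : IsSelfAdjoint (D Complex.I))
    {a : W} (ha : Q 0 a = (1 / 2 : ℂ) • (D 1 (y 0) - Complex.I • D Complex.I (y 0)))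
    (h0 : (inner ℂ (y 0) (Q 0 (y 0))).re ≠ 0) :
    ∃ D', HasLevi (fun z => Real.log (inner ℂ (y z) (Q z (y z))).re / 2) D'
      ((((inner ℂ (y 0) (K (y 0))).re - (inner ℂ a (Q 0 a)).re +
          (inner ℂ (deriv y 0 + a) (Q 0 (deriv y 0 + a))).re) / (inner ℂ (y 0) (Q 0 (y 0))).re -
        ‖inner ℂ (y 0) (Q 0 (deriv y 0 + a))‖ ^ 2 / (inner ℂ (y 0) (Q 0 (y 0))).re ^ 2) / 2) := by
  have hyL := HasLevi.of_differentiable hy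
  set τ := deriv y 0 with hτ
  have h1' : (fderiv ℂ y 0) 1 = τ := fderiv_apply_one_eq_deriv
  have hI' : (fderiv ℂ y 0) Complex.I = Complex.I • τ := by
    rw [← h1', ← map_smul, smul_eq_mul, mul_one]
  -- The product rule is used twice; `y`, being holomorphic, contributes no second order term of its
  -- own.
  have hG := hyL.bilinear (hQ.bilinear hyL (realApply W)) (realInner W)
  have hL := (hG.log h0).const_mul (1 / 2)
  obtain ⟨D', hD'⟩ : ∃ D', HasLevi _ D' _ := ⟨_, hL⟩
  refine ⟨D', ?_⟩
  convert hD' using 1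
  · ext z
    simp only [realInner_apply, realApply_apply]
    ring
  have k1 := re_inner_bracket hsa h1 hI (τ := τ) ha
  have k2 := sq_add_sq_re_inner hsa h1 hI (τ := τ) ha
  simp only [realInner_apply, realApply_apply, ContinuousLinearMap.comp_apply,
    ContinuousLinearMap.prod_apply, ContinuousLinearMap.coe_deriv₂,
    ContinuousLinearMap.coe_restrictScalars', h1', hI', map_zero, zero_add,
    zero_apply, add_zero, k2]
  have k3 : (inner ℂ (y 0) (K (y 0) + (1 / 2 : ℝ) • (D 1 τ + D Complex.I (Complex.I • τ)))).re =
      (inner ℂ (y 0) (K (y 0))).re +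
        (1 / 2 : ℝ) * (inner ℂ (y 0) (D 1 τ + D Complex.I (Complex.I • τ))).re := by
    rw [← realInner_apply, map_add, map_smul]
    rfl
  rw [k3, smul_eq_mul, add_assoc, k1]
  field_simp
  ring

end GramOperator

/-! ### Comparing Levi forms, and curves that are almost flat for the Chern connection. -/

section GramComparison

open Filter

variable {W : Type*} [NormedAddCommGroup W] [InnerProductSpace ℂ W] [CompleteSpace W]

/-- Differentiate `star Q = Q` and use uniqueness of the derivative. -/
lemma HasFDerivAt.isSelfAdjoint_apply {E : Type*} [NormedAddCommGroup E] [NormedSpace ℝ E]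
    {Q : E → W →L[ℂ] W} {D : E →L[ℝ] W →L[ℂ] W} {x : E} (hQ : HasFDerivAt Q D x)
    (hsa : ∀ᶠ z in 𝓝 x, IsSelfAdjoint (Q z)) (v : E) : IsSelfAdjoint (D v) := by
  have h1 := hQ.star
  have h2 : HasFDerivAt (fun z => star (Q z)) D x :=
    hQ.congr_of_eventuallyEq (hsa.mono fun z hz => hz)
  have h3 := congrArg (fun L : E →L[ℝ] W →L[ℂ] W => L v) (h1.unique h2)
  exact h3

/-- Comparison of the generalized Levi forms of `log ⟨Q y, y⟩ / 2` for two holomorphic curves with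
the same value at `0`, the second of which is almost flat there. -/
lemma HasLevi.log_gram_le {Q₁ Q₂ : ℂ → W →L[ℂ] W} {D : ℂ →L[ℝ] W →L[ℂ] W} {K : W →L[ℂ] W}
    (hQ₁ : HasLevi Q₁ D K) (hQ₂ : HasLevi Q₂ D K) (hQ : Q₁ 0 = Q₂ 0) {y₁ y₂ : ℂ → W}
    (hy₁ : ∀ᶠ z in 𝓝 (0 : ℂ), DifferentiableAt ℂ y₁ z)
    (hy₂ : ∀ᶠ z in 𝓝 (0 : ℂ), DifferentiableAt ℂ y₂ z) (hy : y₁ 0 = y₂ 0) (hy0 : y₂ 0 ≠ 0)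
    (hsa : ∀ᶠ z in 𝓝 (0 : ℂ), IsSelfAdjoint (Q₂ z))
    (hpos : ∀ w : W, w ≠ 0 → 0 < (inner ℂ w (Q₂ 0 w)).re) {a : W}
    (ha : Q₂ 0 a = (1 / 2 : ℂ) • (D 1 (y₂ 0) - Complex.I • D Complex.I (y₂ 0))) {ε : ℝ}
    (hε : (inner ℂ (deriv y₂ 0 + a) (Q₂ 0 (deriv y₂ 0 + a))).re ≤
      2 * ε * (inner ℂ (y₂ 0) (Q₂ 0 (y₂ 0))).re) :
    ∃ D₁ D₂ l₁ l₂, HasLevi (fun z => Real.log (inner ℂ (y₁ z) (Q₁ z (y₁ z))).re / 2) D₁ l₁ ∧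
      HasLevi (fun z => Real.log (inner ℂ (y₂ z) (Q₂ z (y₂ z))).re / 2) D₂ l₂ ∧ l₂ - ε ≤ l₁ := by
  have h1 := hQ₂.hasFDerivAt.isSelfAdjoint_apply hsa 1
  have hI := hQ₂.hasFDerivAt.isSelfAdjoint_apply hsa Complex.I
  have hH := hpos _ hy0
  obtain ⟨D₁, hD₁⟩ := hQ₁.log_gram hy₁ (hQ ▸ hsa.self_of_nhds) h1 hI (a := a)
    (by rw [hQ, hy, ha]) (by rw [hQ, hy]; exact hH.ne')
  obtain ⟨D₂, hD₂⟩ := hQ₂.log_gram hy₂ hsa.self_of_nhds h1 hI ha hH.ne'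
  refine ⟨D₁, D₂, _, _, hD₁, hD₂, ?_⟩
  rw [hQ, hy]
  set H := (inner ℂ (y₂ 0) (Q₂ 0 (y₂ 0))).re
  set S₂ := (inner ℂ (deriv y₂ 0 + a) (Q₂ 0 (deriv y₂ 0 + a))).re
  -- For `y₁` the square of the covariant derivative dominates the subtracted term, so dropping both
  -- only lowers the Levi form.
  have hcs := hsa.self_of_nhds.norm_inner_apply_sq_le hpos (y₂ 0) (deriv y₁ 0 + a)
  have e1 : ‖inner ℂ (y₂ 0) (Q₂ 0 (deriv y₁ 0 + a))‖ ^ 2 / H ^ 2 ≤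
      (inner ℂ (deriv y₁ 0 + a) (Q₂ 0 (deriv y₁ 0 + a))).re / H := by
    rw [div_le_div_iff₀ (by positivity) hH]
    calc _ ≤ _ := mul_le_mul_of_nonneg_right hcs hH.le
      _ = _ := by ring
  -- The factor `2` is absorbed by the `1/2` in `log ⟨Q y, y⟩ / 2`.
  have e2 : S₂ / H ≤ 2 * ε := by rwa [div_le_iff₀ hH]
  have e3 : 0 ≤ ‖inner ℂ (y₂ 0) (Q₂ 0 (deriv y₂ 0 + a))‖ ^ 2 / H ^ 2 := by positivity
  rw [add_div _ S₂, add_div _ (inner ℂ (deriv y₁ 0 + a) (Q₂ 0 (deriv y₁ 0 + a))).re]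
  linarith

variable {V : Type*} [NormedAddCommGroup V] [NormedSpace ℂ V]
  {Y : Type*} [NormedAddCommGroup Y] [NormedSpace ℂ Y]

/-- The complex linear part `v ↦ (D v - i D (i v)) / 2` of a real linear map. -/
def ContinuousLinearMap.complexLinearPart (D : V →L[ℝ] Y) : V →L[ℂ] Y where
  toFun v := (1 / 2 : ℂ) • (D v - Complex.I • D (Complex.I • v))
  map_add' v w := by
    simp only [smul_add, map_add]
    module
  map_smul' c v := by
    have e : ∀ v, D (c • v) = c.re • D v + c.im • D (Complex.I • v) := fun v => by
      rw [← map_smul, ← map_smul, ← map_add]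
      congr 1
      conv_lhs => rw [← Complex.re_add_im c]
      rw [add_smul, mul_smul, Complex.coe_smul, Complex.coe_smul]
    have e2 : D (Complex.I • Complex.I • v) = -D v := by
      rw [smul_smul, Complex.I_mul_I, neg_one_smul, map_neg]
    have e3 : c • (D v - Complex.I • D (Complex.I • v)) =
        c.re • (D v - Complex.I • D (Complex.I • v)) +
          c.im • Complex.I • (D v - Complex.I • D (Complex.I • v)) := by
      conv_lhs => rw [← Complex.re_add_im c]
      rw [add_smul, mul_smul, Complex.coe_smul, Complex.coe_smul]
    rw [smul_comm Complex.I c v, e v, e (Complex.I • v), e2, RingHom.id_apply, smul_comm c, e3]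
    congr 1
    simp only [smul_sub, smul_add, smul_smul, Complex.I_mul_I, smul_comm Complex.I (_ : ℝ),
      neg_one_smul, smul_neg]
    module
  cont := by
    have := D.continuous
    fun_prop

lemma ContinuousLinearMap.complexLinearPart_apply (D : V →L[ℝ] Y) (v : V) :
    D.complexLinearPart v = (1 / 2 : ℂ) • (D v - Complex.I • D (Complex.I • v)) := rfl

/-- Almost flat curves: along `y ζ = w - T (x ζ - x z₀) w` the `(1, 0)`-part of the Chern
connection of `P` is small near `z₀`, uniformly in `w`. -/
lemma exists_eventually_almost_flat [CompleteSpace V] {P : V → W →L[ℂ] W} {x : ℂ → V} {z₀ : ℂ}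
    (hP : ContDiffAt ℝ 2 P (x z₀)) (hx : ∀ᶠ z in 𝓝 z₀, DifferentiableAt ℂ x z)
    (hsa : IsSelfAdjoint (P (x z₀))) (hu : IsUnit (P (x z₀)))
    (hpos : ∀ w : W, w ≠ 0 → 0 < (inner ℂ w (P (x z₀) w)).re) :
    ∃ T : V →L[ℂ] W →L[ℂ] W, ∀ ε : ℝ, 0 < ε → ∀ᶠ z in 𝓝 z₀, ∀ w : W, w ≠ 0 →
      w - T (x z - x z₀) w ≠ 0 ∧ ∃ a,
        P (x z) a = (fderiv ℝ P (x z)).complexLinearPart (deriv x z) (w - T (x z - x z₀) w) ∧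
        (inner ℂ (deriv (fun ζ => w - T (x ζ - x z₀) w) z + a)
          (P (x z) (deriv (fun ζ => w - T (x ζ - x z₀) w) z + a))).re ≤
        2 * ε * (inner ℂ (w - T (x z - x z₀) w) (P (x z) (w - T (x z - x z₀) w))).re := by
  set R : W →L[ℂ] W := Ring.inverse (P (x z₀)) with hR
  -- `T = P⁻¹ ∂P` at `x z₀` is the connection form there, so that `w - T (x - x z₀) w` has vanishing
  -- covariant derivative at `z₀`.
  set T : V →L[ℂ] W →L[ℂ] W := (ContinuousLinearMap.compL ℂ W W W R) ∘L
    (fderiv ℝ P (x z₀)).complexLinearPart with hT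
  have hTv : ∀ v, T v = R * (fderiv ℝ P (x z₀)).complexLinearPart v := fun v => rfl
  refine ⟨T, fun ε hε => ?_⟩
  obtain ⟨c, hc, hcoer⟩ := hsa.exists_coercive hu hpos
  have hxd : ContinuousAt (deriv x) z₀ := by
    obtain ⟨s, hs, hso, hz⟩ := eventually_nhds_iff.1 hx
    have : DifferentiableOn ℂ x s := fun z hz => (hs z hz).differentiableWithinAt
    exact (this.analyticAt (hso.mem_nhds hz)).deriv.continuousAt
  have hxc : ContinuousAt x z₀ := hx.self_of_nhds.continuousAt
  have hPx : ContinuousAt (fun z => P (x z)) z₀ := ContinuousAt.comp (g := P) hP.continuousAt hxc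
  have hD : ContinuousAt (fun z => fderiv ℝ P (x z)) z₀ :=
    ContinuousAt.comp (g := fderiv ℝ P)
      (hP.fderiv_right (m := 1) (by norm_num)).continuousAt hxc
  set A : ℂ → W →L[ℂ] W := fun z => (fderiv ℝ P (x z)).complexLinearPart (deriv x z) with hA
  have hAc : ContinuousAt A z₀ := by
    simp only [hA, ContinuousLinearMap.complexLinearPart_apply]
    exact ((hD.clm_apply hxd).sub ((hD.clm_apply (hxd.const_smul Complex.I)).const_smul Complex.I)).const_smul (1 / 2 : ℂ)
  set M : ℂ → W →L[ℂ] W := fun z => 1 - T (x z - x z₀) with hM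
  have hMc : ContinuousAt M z₀ :=
    continuousAt_const.sub (ContinuousAt.comp (g := T) T.continuous.continuousAt
      (hxc.sub continuousAt_const))
  have hM0 : M z₀ = 1 := by simp [hM]
  -- For `y = M w` the covariant derivative `y' + a` is `N w`. Since `N` is a continuous operator
  -- valued function vanishing at `z₀`, norm estimates on `N` and `M` are uniform in `w`.
  set N : ℂ → W →L[ℂ] W := fun z => -T (deriv x z) + Ring.inverse (P (x z)) * (A z * M z) with hN
  have hNc : ContinuousAt N z₀ := by
    have hinv : ContinuousAt (fun z => Ring.inverse (P (x z))) z₀ := by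
      obtain ⟨U, hU⟩ := hu
      have := NormedRing.inverse_continuousAt U
      rw [hU] at this
      exact ContinuousAt.comp (g := Ring.inverse) this hPx
    exact (ContinuousAt.comp (g := T) T.continuous.continuousAt hxd).neg.add
      (hinv.mul (hAc.mul hMc))
  have hN0 : N z₀ = 0 := by
    simp only [hN, hM0, mul_one, hTv, hA, hR]
    simp
  have hstar : ∀ {F : ℂ → W →L[ℂ] W}, ContinuousAt F z₀ →
      ContinuousAt (fun z => star (F z) * P (x z) * F z) z₀ := fun hF =>
    ((continuous_star.continuousAt.comp hF).mul hPx).mul hF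
  have hform : ∀ (B Q : W →L[ℂ] W) (w : W),
      inner ℂ w ((star B * Q * B) w) = inner ℂ (B w) (Q (B w)) := fun B Q w => by
    rw [ContinuousLinearMap.star_eq_adjoint]
    exact ContinuousLinearMap.adjoint_inner_right B w (Q (B w))
  have hbound : ∀ (B : W →L[ℂ] W) (w : W), |(inner ℂ w (B w)).re| ≤ ‖B‖ * ‖w‖ ^ 2 := by
    intro B w
    calc _ ≤ ‖inner ℂ w (B w)‖ := Complex.abs_re_le_norm _
      _ ≤ ‖w‖ * ‖B w‖ := norm_inner_le_norm _ _
      _ ≤ ‖w‖ * (‖B‖ * ‖w‖) := by gcongr; exact B.le_opNorm w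
      _ = _ := by ring
  -- With `c` the coercivity constant at `x z₀`, this keeps the squared norm of `M w` above `(c / 2)
  -- ‖w‖²`. The bound `ε c` in `ev2` is then `2 ε` times `c / 2`.
  have ev1 : ∀ᶠ z in 𝓝 z₀, ‖star (M z) * P (x z) * M z - P (x z₀)‖ < c / 2 := by
    have := (hstar hMc).sub (continuousAt_const (y := P (x z₀)))
    have h0 : ‖star (M z₀) * P (x z₀) * M z₀ - P (x z₀)‖ < c / 2 := by
      rw [hM0, star_one, one_mul, mul_one, sub_self, norm_zero]
      exact half_pos hc
    exact this.norm.eventually (gt_mem_nhds h0)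
  have ev2 : ∀ᶠ z in 𝓝 z₀, ‖star (N z) * P (x z) * N z‖ < ε * c := by
    have h0 : ‖star (N z₀) * P (x z₀) * N z₀‖ < ε * c := by
      rw [hN0, mul_zero, norm_zero]
      positivity
    exact (hstar hNc).norm.eventually (gt_mem_nhds h0)
  have ev3 : ∀ᶠ z in 𝓝 z₀, IsUnit (P (x z)) := hPx.eventually (Units.isOpen.mem_nhds hu)
  filter_upwards [ev1, ev2, ev3, hx] with z h1 h2 h3 h4 w hw
  have hwpos : 0 < ‖w‖ ^ 2 := by positivity
  have hMw : w - T (x z - x z₀) w = M z w := rfl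
  have hH : c / 2 * ‖w‖ ^ 2 ≤ (inner ℂ (M z w) (P (x z) (M z w))).re := by
    have a1 := hbound (star (M z) * P (x z) * M z - P (x z₀)) w
    rw [sub_apply, inner_sub_right, Complex.sub_re, hform] at a1
    have a2 := (abs_le.1 a1).1
    have a3 : ‖star (M z) * P (x z) * M z - P (x z₀)‖ * ‖w‖ ^ 2 ≤ c / 2 * ‖w‖ ^ 2 := by gcongr
    have a4 := hcoer w
    linarith
  have hderiv : deriv (fun ζ => w - T (x ζ - x z₀) w) z = -T (deriv x z) w := by
    have d1 : HasDerivAt (fun ζ => T (x ζ - x z₀)) (T (deriv x z)) z :=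
      T.hasFDerivAt.comp_hasDerivAt z (h4.hasDerivAt.sub_const _)
    have d2 : HasDerivAt (fun ζ => T (x ζ - x z₀) w) (T (deriv x z) w) z := by
      simpa using d1.clm_apply (hasDerivAt_const z w)
    exact (d2.const_sub w).deriv
  refine ⟨fun h0 => ?_, Ring.inverse (P (x z)) (A z (M z w)), ?_, ?_⟩
  · rw [hMw] at h0
    rw [h0] at hH
    simp only [map_zero, inner_zero_left, Complex.zero_re] at hH
    have : 0 < c / 2 * ‖w‖ ^ 2 := by positivity
    linarith
  · rw [hMw]
    have := congrArg (fun B : W →L[ℂ] W => B (A z (M z w))) (Ring.mul_inverse_cancel _ h3)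
    exact this
  · rw [hderiv, hMw]
    have hs : -T (deriv x z) w + Ring.inverse (P (x z)) (A z (M z w)) = N z w := rfl
    rw [hs, ← hform]
    calc _ ≤ ‖star (N z) * P (x z) * N z‖ * ‖w‖ ^ 2 := (le_abs_self _).trans (hbound _ w)
      _ ≤ ε * c * ‖w‖ ^ 2 := by gcongr
      _ = 2 * ε * (c / 2 * ‖w‖ ^ 2) := by ring
      _ ≤ _ := by gcongr

end GramComparison

/-! ### Locality and translation invariance of `circleLevi`. -/

section Congr

open Filter

lemma circleAverage_eventuallyEq {E : Type*} [NormedAddCommGroup E] [NormedSpace ℝ E]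
    {F F' : ℂ → E} {z : ℂ} (h : F =ᶠ[𝓝 z] F') :
    ∀ᶠ r in 𝓝[>] (0 : ℝ), Real.circleAverage F z r = Real.circleAverage F' z r := by
  filter_upwards [nhdsWithin_le_nhds (eventually_forall_mem_sphere h)] with r hr
  exact Real.circleAverage_congr_sphere hr

lemma HasLevi.congr {E : Type*} [NormedAddCommGroup E] [NormedSpace ℝ E] {F F' : ℂ → E}
    {D : ℂ →L[ℝ] E} {k : E} (hF : HasLevi F D k) (h : F =ᶠ[𝓝 0] F') : HasLevi F' D k := by
  refine ⟨hF.hasFDerivAt.congr_of_eventuallyEq h.symm, ?_, hF.tendsto.congr' ?_⟩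
  · filter_upwards [hF.eventually_continuousAt, h.eventuallyEq_nhds] with z h1 h2
    exact h1.congr h2
  · filter_upwards [circleAverage_eventuallyEq h] with r hr
    rw [hr, h.self_of_nhds]

lemma circleLevi_congr {u u' : ℂ → ℝ} {z : ℂ} (h : u =ᶠ[𝓝 z] u') :
    circleLevi u z = circleLevi u' z := by
  refine limsup_congr ?_
  filter_upwards [circleAverage_eventuallyEq h] with r hr
  rw [hr, h.self_of_nhds]

lemma circleLevi_comp_add (u : ℂ → ℝ) (z : ℂ) :
    circleLevi (fun ζ => u (z + ζ)) 0 = circleLevi u z := by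
  have : ∀ r, Real.circleAverage (fun ζ => u (z + ζ)) 0 r = Real.circleAverage u z r := fun r => by
    simpa only [add_comm] using Real.circleAverage_map_add_const (f := u) (c := z) (R := r)
  simp only [circleLevi, this, add_zero]

end Congr

/-! ### Passing to charts; the real structure of a complex manifold. -/

section RealStructure

variable {V : Type*} [NormedAddCommGroup V] [NormedSpace ℂ V]
    {S : Type u} [TopologicalSpace S] [ChartedSpace V S]

/-- A complex manifold is a real manifold. -/
lemma isManifold_real [IsManifold 𝓘(ℂ, V) ∞ S] : IsManifold 𝓘(ℝ, V) ∞ S := by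
  refine isManifold_of_contDiffOn _ _ _ fun e e' he he' => ?_
  have h := HasGroupoid.compatible (G := contDiffGroupoid ∞ 𝓘(ℂ, V)) he he'
  rw [contDiffGroupoid, mem_groupoid_of_pregroupoid] at h
  have h1 : ContDiffOn ℂ ∞ (𝓘(ℂ, V) ∘ (e.symm ≫ₕ e') ∘ 𝓘(ℂ, V).symm)
    (𝓘(ℂ, V).symm ⁻¹' (e.symm ≫ₕ e').source ∩ Set.range 𝓘(ℂ, V)) := h.1
  exact h1.restrict_scalars ℝ

lemma contDiffAt_comp_chart_symm [IsManifold 𝓘(ℂ, V) ∞ S] {Y : Type*} [NormedAddCommGroup Y]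
    [NormedSpace ℝ Y] {P : S → Y} {s s₀ : S} (hs : s ∈ (chartAt V s₀).source)
    (hP : ContMDiffAt 𝓘(ℝ, V) 𝓘(ℝ, Y) 2 P s) :
    ContDiffAt ℝ 2 (fun x => P ((chartAt V s₀).symm x)) (chartAt V s₀ s) := by
  have : IsManifold 𝓘(ℝ, V) ∞ S := isManifold_real
  have h1 : ContMDiffAt 𝓘(ℝ, V) 𝓘(ℝ, V) 2 (chartAt V s₀).symm (chartAt V s₀ s) :=
    (((contMDiffOn_chart_symm (I := 𝓘(ℝ, V)) (n := ∞) (x := s₀)) _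
      ((chartAt V s₀).map_source hs)).contMDiffAt
      ((chartAt V s₀).open_target.mem_nhds ((chartAt V s₀).map_source hs))).of_le
      (WithTop.coe_le_coe.2 (le_top : (2 : ℕ∞) ≤ ⊤))
  rw [← contMDiffAt_iff_contDiffAt]
  refine ContMDiffAt.comp (g := P) _ ?_ h1
  rwa [(chartAt V s₀).left_inv hs]

lemma contMDiffAt_chartAt [IsManifold 𝓘(ℂ, V) ∞ S] {s s₀ : S} (hs : s ∈ (chartAt V s₀).source) :
    ContMDiffAt 𝓘(ℂ, V) 𝓘(ℂ, V) ∞ (chartAt V s₀) s :=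
  contMDiffOn_chart.contMDiffAt ((chartAt V s₀).open_source.mem_nhds hs)

lemma ContMDiffAt.differentiableAt_chartAt_comp [IsManifold 𝓘(ℂ, V) ∞ S] {g : ℂ → S} {z : ℂ}
    {s₀ : S} (hg : ContMDiffAt 𝓘(ℂ, ℂ) 𝓘(ℂ, V) ∞ g z) (hz : g z ∈ (chartAt V s₀).source) :
    DifferentiableAt ℂ (fun ζ => chartAt V s₀ (g ζ)) z := by
  have h : ContMDiffAt 𝓘(ℂ, ℂ) 𝓘(ℂ, V) ∞ (fun ζ => chartAt V s₀ (g ζ)) z :=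
    ContMDiffAt.comp (g := chartAt V s₀) z (contMDiffAt_chartAt hz) hg
  exact (contMDiffAt_iff_contDiffAt.1 h).differentiableAt (by simp)

/-- Tangent vectors in the bundle are expressed in the preferred chart at their base point. Applying
the tangent map of the fixed chart at `s₀` moves the equality into that chart, where the Gram
operators live. -/
lemma fderiv_chartAt_comp_eq [IsManifold 𝓘(ℂ, V) ∞ S] {g γ : ℂ → S} {s₀ : S}
    (hg : ContMDiffAt 𝓘(ℂ, ℂ) 𝓘(ℂ, V) ∞ g 0) (hγ : ContMDiffAt 𝓘(ℂ, ℂ) 𝓘(ℂ, V) ∞ γ 0)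
    (hγ0 : γ 0 ∈ (chartAt V s₀).source)
    (h : tangentMap 𝓘(ℂ, ℂ) 𝓘(ℂ, V) g ⟨0, (1 : ℂ)⟩ = tangentMap 𝓘(ℂ, ℂ) 𝓘(ℂ, V) γ ⟨0, (1 : ℂ)⟩) :
    fderiv ℂ (fun ζ => chartAt V s₀ (g ζ)) 0 = fderiv ℂ (fun ζ => chartAt V s₀ (γ ζ)) 0 := by
  have h0 : g 0 = γ 0 := congrArg (fun p : TangentBundle 𝓘(ℂ, V) S => p.1) h
  have key : ∀ k : ℂ → S, ContMDiffAt 𝓘(ℂ, ℂ) 𝓘(ℂ, V) ∞ k 0 → k 0 ∈ (chartAt V s₀).source →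
      fderiv ℂ (fun ζ => chartAt V s₀ (k ζ)) 0 1 =
        (show V from (tangentMap 𝓘(ℂ, V) 𝓘(ℂ, V) (chartAt V s₀)
          (tangentMap 𝓘(ℂ, ℂ) 𝓘(ℂ, V) k ⟨0, (1 : ℂ)⟩)).2) := by
    intro k hk hk0
    rw [← tangentMap_comp_at _ ((contMDiffAt_chartAt hk0).mdifferentiableAt (by simp))
      (hk.mdifferentiableAt (by simp))]
    rw [← mfderiv_eq_fderiv]
    rfl
  ext
  rw [key g hg (h0 ▸ hγ0), key γ hγ hγ0, h]

end RealStructure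

/-! ### Holomorphic sections and their norms in a trivialization. -/

section SectionCoordinates

variable {V : Type*} [NormedAddCommGroup V] [NormedSpace ℂ V]
    {S : Type u} [TopologicalSpace S] [ChartedSpace V S]
    {W : Type*} [NormedAddCommGroup W] [InnerProductSpace ℂ W]
    {E : S → Type v} [TopologicalSpace (TotalSpace W E)] [∀ s, AddCommGroup (E s)]
    [∀ s, Module ℂ (E s)] [∀ s, TopologicalSpace (E s)]
    [FiberBundle W E] [VectorBundle ℂ W E]

/-- The value of a local section of a bundle, extended by zero. -/
def LocalSection.value {s : S} (φ : LocalSection (sectionSheaf V W E) s) (x : S) : E x :=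
  extendSection (U := (φ.dom : Set S)) (fun y => sectionEval φ.sec y) x

lemma LocalSection.value_apply {s : S} (φ : LocalSection (sectionSheaf V W E) s) {x : S}
    (hx : x ∈ φ.dom) : φ.value x = sectionEval φ.sec ⟨x, hx⟩ :=
  extendSection_apply (U := (φ.dom : Set S)) (fun y => sectionEval φ.sec y) ⟨x, hx⟩

variable [IsManifold 𝓘(ℂ, V) ∞ S] [ContMDiffVectorBundle ∞ W E 𝓘(ℂ, V)]

lemma LocalSection.differentiableAt_trivialization {s : S}
    (φ : LocalSection (sectionSheaf V W E) s) (e : Trivialization W (π W E))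
    [MemTrivializationAtlas e] {g : ℂ → S} {z : ℂ} (hg : ContMDiffAt 𝓘(ℂ, ℂ) 𝓘(ℂ, V) ∞ g z)
    (hz : g z ∈ φ.dom) (hz' : g z ∈ e.baseSet) :
    DifferentiableAt ℂ (fun ζ => (e ⟨g ζ, φ.value (g ζ)⟩).2) z := by
  have h1 : ContMDiffAt 𝓘(ℂ, V) (𝓘(ℂ, V).prod 𝓘(ℂ, W)) ∞
      (fun y : S => (⟨y, φ.value y⟩ : TotalSpace W E)) (g z) :=
    (isHolSection_iff V W _).1 (show holSections V W E _ from φ.sec).2 _ hz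
  have h2 := (e.contMDiffAt_section_iff hz').1 h1
  exact (contMDiffAt_iff_contDiffAt.1
    (ContMDiffAt.comp (g := fun y => (e ⟨y, φ.value y⟩).2) z h2 hg)).differentiableAt (by simp)

variable [CompleteSpace W]

/-- The `1/2` comes from the square root in the norm. The formula also holds at zeros of the
section, where both sides are `0` by the convention `Real.log 0 = 0`. -/
lemma HermitianMetric.logNorm_eq (h : HermitianMetric V W E) {e : Trivialization W (π W E)}
    {P : S → W →L[ℂ] W}
    (hP : ∀ s ∈ e.baseSet, IsSelfAdjoint (P s) ∧ IsUnit (P s) ∧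
        (∀ w : W, w ≠ 0 → 0 < (inner ℂ w (P s w)).re) ∧
        ∀ v w : E s, h.toFun s v w = inner ℂ (e ⟨s, w⟩).2 (P s (e ⟨s, v⟩).2))
    {s x : S} (φ : LocalSection (sectionSheaf V W E) s) (hx : x ∈ φ.dom) (hx' : x ∈ e.baseSet) :
    h.sheafMetric.logNorm φ x =
      Real.log (inner ℂ (e ⟨x, φ.value x⟩).2 (P x (e ⟨x, φ.value x⟩).2)).re / 2 := by
  obtain ⟨-, -, hpos, hform⟩ := hP x hx'
  have h1 : h.sheafMetric.logNorm φ x = Real.log (h.norm (φ.value x)) := by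
    rw [SheafMetric.logNorm, dif_pos hx, φ.value_apply hx]
    rfl
  have h2 : 0 ≤ (inner ℂ (e ⟨x, φ.value x⟩).2 (P x (e ⟨x, φ.value x⟩).2)).re := by
    by_cases h0 : (e ⟨x, φ.value x⟩).2 = 0
    · simp [h0]
    · exact (hpos _ h0).le
  rw [h1, HermitianMetric.norm, hform, Real.coe_toNNReal _ (Real.sqrt_nonneg _), Real.log_sqrt h2]

/-- The local section with coordinates `w - T (χ x - x₀) w`, where `χ` is the chart at `s₀`. -/
def affineSection (s₀ : S) (T : V →L[ℂ] W →L[ℂ] W) (x₀ : V) (w : W) {U : Opens S}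
    (hU : ∀ x ∈ U, x ∈ (chartAt V s₀).source)
    (hU' : ∀ x ∈ U, x ∈ (trivializationAt W E s₀).baseSet) :
    (sectionSheaf V W E).val.obj (op U) :=
  show holSections V W E U from
  ⟨fun x => (trivializationAt W E s₀).symm x (w - T (chartAt V s₀ x - x₀) w), by
    refine (isHolSection_iff V W _).2 fun x hx => ?_
    refine ((trivializationAt W E s₀).contMDiffAt_section_iff (hU' x hx)).2 ?_
    have h1 : ContDiff ℂ ∞ fun v : V => w - T (v - x₀) w :=
      contDiff_const.sub ((T.contDiff.comp (contDiff_id.sub contDiff_const)).clm_apply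
        contDiff_const)
    have h2 : ContMDiffAt 𝓘(ℂ, V) 𝓘(ℂ, W) ∞ (fun y : S => w - T (chartAt V s₀ y - x₀) w) x :=
      ContMDiffAt.comp (g := fun v : V => w - T (v - x₀) w) x h1.contMDiff.contMDiffAt
        (contMDiffAt_chartAt (hU x hx))
    refine h2.congr_of_eventuallyEq ?_
    filter_upwards [U.isOpen.mem_nhds hx] with y hy
    rw [extendSection_apply (U := (U : Set S)) (E := E) _ ⟨y, hy⟩]
    exact congrArg Prod.snd ((trivializationAt W E s₀).apply_mk_symm (hU' y hy) _)⟩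

lemma sectionEval_affineSection (s₀ : S) (T : V →L[ℂ] W →L[ℂ] W) (x₀ : V) (w : W) {U : Opens S}
    (hU : ∀ x ∈ U, x ∈ (chartAt V s₀).source)
    (hU' : ∀ x ∈ U, x ∈ (trivializationAt W E s₀).baseSet) (x : U) :
    sectionEval (affineSection (E := E) s₀ T x₀ w hU hU') x =
      (trivializationAt W E s₀).symm x (w - T (chartAt V s₀ x - x₀) w) := rfl

end SectionCoordinates

/-! ### Almost flat sections nearly minimize the Levi form. -/

section AlmostFlatSections

open Filter

variable {V : Type*} [NormedAddCommGroup V] [NormedSpace ℂ V] [CompleteSpace V]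
    {S : Type u} [TopologicalSpace S] [ChartedSpace V S] [IsManifold 𝓘(ℂ, V) ∞ S]
    {W : Type*} [NormedAddCommGroup W] [InnerProductSpace ℂ W] [CompleteSpace W]
    {E : S → Type v} [TopologicalSpace (TotalSpace W E)] [∀ s, AddCommGroup (E s)]
    [∀ s, Module ℂ (E s)] [∀ s, TopologicalSpace (E s)]
    [FiberBundle W E] [VectorBundle ℂ W E] [ContMDiffVectorBundle ∞ W E 𝓘(ℂ, V)]

lemma eventually_contMDiffAt_comp_add {f : ℂ → S} {z : ℂ}
    (hf : ∀ᶠ ζ in 𝓝 z, ContMDiffAt 𝓘(ℂ, ℂ) 𝓘(ℂ, V) ∞ f ζ) :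
    ∀ᶠ ζ in 𝓝 (0 : ℂ), ContMDiffAt 𝓘(ℂ, ℂ) 𝓘(ℂ, V) ∞ (fun ζ => f (z + ζ)) ζ := by
  have hc : ContinuousAt (fun ζ : ℂ => z + ζ) 0 := by fun_prop
  have h1 : ∀ᶠ ζ in 𝓝 (0 : ℂ), ContMDiffAt 𝓘(ℂ, ℂ) 𝓘(ℂ, V) ∞ f (z + ζ) :=
    hc.eventually (by simpa using hf)
  filter_upwards [h1] with ζ hζ
  refine ContMDiffAt.comp (g := f) ζ hζ ?_
  rw [contMDiffAt_iff_contDiffAt]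
  fun_prop

/-- Near any point of a holomorphic curve `f` there are holomorphic sections of `E` with arbitrary
value at that point, whose logarithmic norm along `f` has nearly minimal generalized Levi form,
uniformly in the section. -/
theorem HermitianMetric.exists_almost_flat_sections (h : HermitianMetric V W E) {f : ℂ → S}
    {z₀ : ℂ} (hf : ∀ᶠ z in 𝓝 z₀, ContMDiffAt 𝓘(ℂ, ℂ) 𝓘(ℂ, V) ∞ f z) :
    ∃ (U : Opens S) (hU : f z₀ ∈ U) (φ : W → (sectionSheaf V W E).val.obj (op U)),
      (∀ v : E (f z₀), ∃ w, sectionEval (φ w) ⟨f z₀, hU⟩ = v ∧ (v ≠ 0 → w ≠ 0)) ∧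
      ∀ ε : ℝ, 0 < ε → ∀ᶠ z in 𝓝 z₀, ∀ w : W, w ≠ 0 → ∀ γ : ℂ → S, γ = (fun ζ => f (z + ζ)) →
        ∃ hz : γ 0 ∈ U, h.sheafMetric.toFun U (φ w) ⟨γ 0, hz⟩ ≠ 0 ∧
          ∃ D l, HasLevi (fun ζ => h.sheafMetric.logNorm ⟨U, hz, φ w⟩ (γ ζ)) D l ∧
            ∀ ψ : LocalSection (sectionSheaf V W E) (γ 0),
              sectionEval ψ.sec ⟨γ 0, ψ.mem⟩ = sectionEval (φ w) ⟨γ 0, hz⟩ → ∀ g : ℂ → S,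
              (∀ᶠ ζ in 𝓝 (0 : ℂ), ContMDiffAt 𝓘(ℂ, ℂ) 𝓘(ℂ, V) ∞ g ζ) →
              tangentMap 𝓘(ℂ, ℂ) 𝓘(ℂ, V) g ⟨0, (1 : ℂ)⟩ =
                tangentMap 𝓘(ℂ, ℂ) 𝓘(ℂ, V) γ ⟨0, (1 : ℂ)⟩ →
              ((l - ε : ℝ) : EReal) ≤ circleLevi (h.sheafMetric.logNorm ψ ∘ g) 0 := by
  set s₀ := f z₀ with hs₀
  set e := trivializationAt W E s₀ with he
  obtain ⟨P, hPs, hP⟩ := h.exists_gram e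
  let U : Opens S := ⟨(chartAt V s₀).source ∩ e.baseSet,
    (chartAt V s₀).open_source.inter e.open_baseSet⟩
  have hU₀ : s₀ ∈ U := ⟨mem_chart_source V s₀, FiberBundle.mem_baseSet_trivializationAt' s₀⟩
  have hUc : ∀ x ∈ U, x ∈ (chartAt V s₀).source := fun x hx => hx.1
  have hUe : ∀ x ∈ U, x ∈ e.baseSet := fun x hx => hx.2
  set χ := chartAt V s₀ with hχ
  set x : ℂ → V := fun ζ => χ (f ζ) with hx
  set G : V → W →L[ℂ] W := fun y => P (χ.symm y) with hG
  have hGχ : ∀ s ∈ U, G (χ s) = P s := fun s hs => by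
    simp only [hG, χ.left_inv (hUc s hs)]
  have hGd : ∀ s ∈ U, ContDiffAt ℝ 2 G (χ s) := fun s hs =>
    contDiffAt_comp_chart_symm (hUc s hs) (hPs.contMDiffAt (e.open_baseSet.mem_nhds (hUe s hs)))
  have hfU : ∀ᶠ z in 𝓝 z₀, f z ∈ U :=
    hf.self_of_nhds.continuousAt.eventually (U.isOpen.mem_nhds hU₀)
  have hxd : ∀ᶠ z in 𝓝 z₀, DifferentiableAt ℂ x z := by
    filter_upwards [hf, hfU] with z h1 h2
    exact h1.differentiableAt_chartAt_comp (hUc _ h2)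
  have hx₀ : x z₀ = χ s₀ := rfl
  obtain ⟨hsa₀, hu₀, hpos₀, -⟩ := hP s₀ (hUe _ hU₀)
  obtain ⟨T, hT⟩ := exists_eventually_almost_flat (P := G) (x := x) (z₀ := z₀) (hGd s₀ hU₀) hxd
    (by rw [hx₀, hGχ _ hU₀]; exact hsa₀) (by rw [hx₀, hGχ _ hU₀]; exact hu₀)
    (by rw [hx₀, hGχ _ hU₀]; exact hpos₀)
  have heval : ∀ (w : W) (y : S) (hy : y ∈ U),
      (e ⟨y, sectionEval (affineSection (E := E) s₀ T (x z₀) w hUc hUe) ⟨y, hy⟩⟩).2 =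
        w - T (χ y - x z₀) w := fun w y hy => by
    rw [sectionEval_affineSection]
    exact congrArg Prod.snd (e.apply_mk_symm (hUe y hy) _)
  refine ⟨U, hU₀, fun w => affineSection s₀ T (x z₀) w hUc hUe, fun v => ?_, fun ε hε => ?_⟩
  · refine ⟨(e ⟨s₀, v⟩).2, ?_, fun hv h0 => hv ?_⟩
    · rw [sectionEval_affineSection]
      rw [hx₀]
      simp only [sub_self, map_zero, zero_apply, sub_zero, hχ]
      exact e.symm_apply_apply_mk (hUe _ hU₀) v
    · let L := e.continuousLinearEquivAt ℂ s₀ (hUe _ hU₀)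
      exact L.injective ((show L v = 0 from h0).trans (map_zero L).symm)
  -- The neighbourhood is fixed before `w` is introduced. The curve `γ` is kept as a variable with
  -- an equation so that all germs are based at `γ 0` and need not be transported from `f (z + 0)`
  -- to `f z`.
  filter_upwards [hT ε hε, hfU.eventually_nhds, hf.eventually_nhds] with z hTz hUz hfz w hw γ hγ
  have hγ0 : γ 0 = f z := by simp [hγ]
  have hz : γ 0 ∈ U := hγ0 ▸ hUz.self_of_nhds
  have hγs : ∀ᶠ ζ in 𝓝 (0 : ℂ), ContMDiffAt 𝓘(ℂ, ℂ) 𝓘(ℂ, V) ∞ γ ζ := by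
    rw [hγ]
    exact eventually_contMDiffAt_comp_add hfz
  have hγU : ∀ᶠ ζ in 𝓝 (0 : ℂ), γ ζ ∈ U :=
    hγs.self_of_nhds.continuousAt.eventually (U.isOpen.mem_nhds hz)
  obtain ⟨hne, a, ha, hsmall⟩ := hTz w hw
  set φ := affineSection (E := E) s₀ T (x z₀) w hUc hUe with hφ
  set y : ℂ → W := fun ζ => w - T (x (z + ζ) - x z₀) w with hy
  have hxγ : ∀ ζ, χ (γ ζ) = x (z + ζ) := fun ζ => by rw [hγ]
  have hyγ : ∀ ζ, (hζ : γ ζ ∈ U) → (e ⟨γ ζ, sectionEval φ ⟨γ ζ, hζ⟩⟩).2 = y ζ := fun ζ hζ => by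
    rw [heval, hxγ]
  have hy0 : y 0 ≠ 0 := by simpa [hy] using hne
  have hxγd : ∀ᶠ ζ in 𝓝 (0 : ℂ), DifferentiableAt ℂ (fun ζ => χ (γ ζ)) ζ := by
    filter_upwards [hγs, hγU] with ζ h1 h2
    exact h1.differentiableAt_chartAt_comp (hUc _ h2)
  have hyd : ∀ᶠ ζ in 𝓝 (0 : ℂ), DifferentiableAt ℂ y ζ := by
    filter_upwards [hxγd] with ζ h1
    simp only [hxγ] at h1
    have h2 : DifferentiableAt ℂ (fun ζ => T (x (z + ζ) - x z₀)) ζ :=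
      T.differentiableAt.comp ζ (h1.sub_const _)
    exact (h2.clm_apply (differentiableAt_const w)).const_sub w
  have hTay := (hGd _ hz).hasTaylorTwo
  have hlev := (HasLevi.of_differentiable hxγd).comp hTay
  have hpU := hP _ (hUe _ hz)
  have hGγ : G (χ (γ 0)) = P (γ 0) := hGχ _ hz
  have hder : deriv y 0 = deriv (fun ζ => w - T (x ζ - x z₀) w) z := by
    have := deriv_comp_const_add (f := fun ζ => w - T (x ζ - x z₀) w) z 0
    rwa [add_zero] at this
  have hderx : deriv (fun ζ => χ (γ ζ)) 0 = deriv x z := by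
    simp only [hxγ]
    have := deriv_comp_const_add (f := x) z 0
    rwa [add_zero] at this
  have hsaγ : ∀ᶠ ζ in 𝓝 (0 : ℂ), IsSelfAdjoint (G (χ (γ ζ))) := by
    filter_upwards [hγU] with ζ hζ
    rw [hGχ _ hζ]
    exact (hP _ (hUe _ hζ)).1
  have hposγ : ∀ w : W, w ≠ 0 → 0 < (inner ℂ w (G (χ (γ 0)) w)).re := by
    rw [hGγ]
    exact hpU.2.2.1
  have hy0' : y 0 = w - T (x z - x z₀) w := by simp [hy]
  have hx0' : χ (γ 0) = x z := by rw [hxγ, add_zero]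
  have ha' : G (χ (γ 0)) a = (1 / 2 : ℂ) • (((fderiv ℝ G (χ (γ 0))) ∘L
      ((fderiv ℂ (fun ζ => χ (γ ζ)) 0).restrictScalars ℝ)) 1 (y 0) -
        Complex.I • ((fderiv ℝ G (χ (γ 0))) ∘L
      ((fderiv ℂ (fun ζ => χ (γ ζ)) 0).restrictScalars ℝ)) Complex.I (y 0)) := by
    rw [hx0', ha, hy0', ContinuousLinearMap.complexLinearPart_apply]
    simp only [ContinuousLinearMap.comp_apply, ContinuousLinearMap.coe_restrictScalars',
      fderiv_eq_smul_deriv, hderx, one_smul]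
    rfl
  have hsmall' : (inner ℂ (deriv y 0 + a) (G (χ (γ 0)) (deriv y 0 + a))).re ≤
      2 * ε * (inner ℂ (y 0) (G (χ (γ 0)) (y 0))).re := by
    rw [hx0', hder, hy0']
    exact hsmall
  have hlog : (fun ζ => Real.log (inner ℂ (y ζ) (G (χ (γ ζ)) (y ζ))).re / 2) =ᶠ[𝓝 0]
      fun ζ => h.sheafMetric.logNorm (⟨U, hz, φ⟩ : LocalSection _ (γ 0)) (γ ζ) := by
    filter_upwards [hγU] with ζ hζ
    rw [h.logNorm_eq hP _ hζ (hUe _ hζ), LocalSection.value_apply _ hζ, hyγ ζ hζ, hGχ _ hζ]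
  have hcmp : ∀ ψ : LocalSection (sectionSheaf V W E) (γ 0),
      sectionEval ψ.sec ⟨γ 0, ψ.mem⟩ = sectionEval φ ⟨γ 0, hz⟩ → ∀ g : ℂ → S,
      (∀ᶠ ζ in 𝓝 (0 : ℂ), ContMDiffAt 𝓘(ℂ, ℂ) 𝓘(ℂ, V) ∞ g ζ) →
      tangentMap 𝓘(ℂ, ℂ) 𝓘(ℂ, V) g ⟨0, (1 : ℂ)⟩ =
        tangentMap 𝓘(ℂ, ℂ) 𝓘(ℂ, V) γ ⟨0, (1 : ℂ)⟩ →
      ∃ D₁ D₂ l₁ l₂, HasLevi (h.sheafMetric.logNorm ψ ∘ g) D₁ l₁ ∧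
        HasLevi (fun ζ => h.sheafMetric.logNorm (⟨U, hz, φ⟩ : LocalSection _ (γ 0)) (γ ζ)) D₂ l₂ ∧
        l₂ - ε ≤ l₁ := by
    intro ψ hψ g hg hgt
    have hg0 : g 0 = γ 0 := congrArg (fun p : TangentBundle 𝓘(ℂ, V) S => p.1) hgt
    have hgc : ContinuousAt g 0 := hg.self_of_nhds.continuousAt
    have hgU : ∀ᶠ ζ in 𝓝 (0 : ℂ), g ζ ∈ U :=
      hgc.eventually (U.isOpen.mem_nhds (by rw [hg0]; exact hz))
    have hgψ : ∀ᶠ ζ in 𝓝 (0 : ℂ), g ζ ∈ ψ.dom :=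
      hgc.eventually (ψ.dom.isOpen.mem_nhds (by rw [hg0]; exact ψ.mem))
    have hxgd : ∀ᶠ ζ in 𝓝 (0 : ℂ), DifferentiableAt ℂ (fun ζ => χ (g ζ)) ζ := by
      filter_upwards [hg, hgU] with ζ h1 h2
      exact h1.differentiableAt_chartAt_comp (hUc _ h2)
    have hygd : ∀ᶠ ζ in 𝓝 (0 : ℂ),
        DifferentiableAt ℂ (fun ζ => (e ⟨g ζ, ψ.value (g ζ)⟩).2) ζ := by
      filter_upwards [hg, hgU, hgψ] with ζ h1 h2 h3
      exact ψ.differentiableAt_trivialization e h1 h3 (hUe _ h2)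
    -- Since holomorphic curves have no second order term, equal first derivatives give `G` along
    -- `g` and along `γ` the same data `D`, `K`, as `HasLevi.log_gram_le` requires.
    have hfd : fderiv ℂ (fun ζ => χ (g ζ)) 0 = fderiv ℂ (fun ζ => χ (γ ζ)) 0 :=
      fderiv_chartAt_comp_eq hg.self_of_nhds hγs.self_of_nhds (hUc _ hz) hgt
    have hlevg := (HasLevi.of_differentiable hxgd).comp (P := G) (by rw [hg0]; exact hTay)
    rw [hfd] at hlevg
    have hyeq : (e ⟨g 0, ψ.value (g 0)⟩).2 = y 0 := by
      rw [← hyγ 0 hz, ← hψ, ← ψ.value_apply ψ.mem]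
      exact congrArg (fun q => (e ⟨q, ψ.value q⟩).2) hg0
    obtain ⟨D₁, D₂, l₁, l₂, h1, h2, h3⟩ := hlevg.log_gram_le hlev (by simp only [hg0]) hygd hyd
      hyeq hy0 hsaγ hposγ ha' hsmall'
    refine ⟨D₁, D₂, l₁, l₂, h1.congr ?_, h2.congr hlog, h3⟩
    filter_upwards [hgU, hgψ] with ζ h1 h2
    rw [Function.comp_apply, h.logNorm_eq hP _ h2 (hUe _ h1), hGχ _ h1]
  refine ⟨hz, fun h0 => hy0 ?_, ?_⟩
  · have h1 : sectionEval φ ⟨γ 0, hz⟩ = 0 := (h.norm_eq_zero_iff _).1 h0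
    rw [← hyγ 0 hz, h1]
    exact map_zero (e.continuousLinearEquivAt ℂ (γ 0) (hUe _ hz))
  -- Comparing the section with itself supplies its Levi data. The number `l` agrees with every
  -- later `l₂` because both equal the same `circleLevi`.
  obtain ⟨-, D, -, l, -, hD, -⟩ := hcmp ⟨U, hz, φ⟩ rfl γ hγs rfl
  refine ⟨D, l, hD, fun ψ hψ g hg hgt => ?_⟩
  obtain ⟨D₁, D₂, l₁, l₂, h1, h2, h3⟩ := hcmp ψ hψ g hg hgt
  have hl : l = l₂ := by
    have := hD.circleLevi_eq.symm.trans h2.circleLevi_eq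
    exact_mod_cast this
  rw [h1.circleLevi_eq, EReal.coe_le_coe_iff, hl]
  exact h3

end AlmostFlatSections

/-! ### Subtracting a function whose Levi form is a limit. -/

section LeviSub

open Filter

/-- A limsup is additive when one summand converges; this is why `F` must satisfy `HasLevi` and not
merely a bound on its `circleLevi`. -/
lemma HasLevi.le_circleLevi_sub {u F : ℂ → ℝ} {D : ℂ →L[ℝ] ℝ} {k a : ℝ} (hF : HasLevi F D k)
    (hu : ∀ᶠ z in 𝓝 (0 : ℂ), ContinuousAt u z) (ha : (a : EReal) ≤ circleLevi u 0) :
    ((a - k : ℝ) : EReal) ≤ circleLevi (fun z => u z - F z) 0 := by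
  refine coe_le_of_forall_pos_sub_le fun ε hε => ?_
  have h1 : ((a - ε / 2 : ℝ) : EReal) < circleLevi u 0 :=
    lt_of_lt_of_le (by rw [EReal.coe_lt_coe_iff]; linarith) ha
  have h2 := frequently_lt_of_lt_limsup (by isBoundedDefault) h1
  have h3 : ∀ᶠ r : ℝ in 𝓝[>] 0, (r ^ 2)⁻¹ • (Real.circleAverage F 0 r - F 0) < k + ε / 2 :=
    hF.tendsto.eventually (gt_mem_nhds (by linarith))
  refine le_limsup_of_frequently_le ?_ (by isBoundedDefault)
  have j1 : ∀ᶠ r in 𝓝[>] (0 : ℝ), CircleIntegrable u 0 r :=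
    nhdsWithin_le_nhds (circleIntegrable_of_eventually_continuousAt hu)
  have j2 : ∀ᶠ r in 𝓝[>] (0 : ℝ), CircleIntegrable F 0 r :=
    nhdsWithin_le_nhds (circleIntegrable_of_eventually_continuousAt hF.eventually_continuousAt)
  refine (h2.and_eventually (h3.and (j1.and j2))).mono ?_
  rintro r ⟨h4, h5, i1, i2⟩
  rw [EReal.coe_lt_coe_iff] at h4
  rw [EReal.coe_le_coe_iff, Real.circleAverage_fun_sub i1 i2]
  rw [smul_eq_mul, ← div_eq_inv_mul] at h5
  have : (Real.circleAverage u 0 r - Real.circleAverage F 0 r - (u 0 - F 0)) / r ^ 2 =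
      (Real.circleAverage u 0 r - u 0) / r ^ 2 - (Real.circleAverage F 0 r - F 0) / r ^ 2 := by
    ring
  rw [this]
  linarith

end LeviSub

/-! ### The norm of a homomorphism and the use of the curvature inequality. -/

section HomNorm

variable {V : Type*} [NormedAddCommGroup V] [NormedSpace ℂ V]
    {S : Type u} [TopologicalSpace S] [ChartedSpace V S]

open Classical in
/-- The norm of a section over `U`, extended by zero. -/
def SheafMetric.valueAt {F : SheafOfModules.{w} (holSheaf V S)} (p : SheafMetric F) {U : Opens S}
    (φ : F.val.obj (op U)) (x : S) : ℝ :=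
  if hx : x ∈ U then p.toFun U φ ⟨x, hx⟩ else 0

lemma SheafMetric.valueAt_of_mem {F : SheafOfModules.{w} (holSheaf V S)} (p : SheafMetric F)
    {U : Opens S} (φ : F.val.obj (op U)) {x : S} (hx : x ∈ U) :
    p.valueAt φ x = p.toFun U φ ⟨x, hx⟩ := dif_pos hx

lemma SheafMetric.valueAt_nonneg {F : SheafOfModules.{w} (holSheaf V S)} (p : SheafMetric F)
    {U : Opens S} (φ : F.val.obj (op U)) (x : S) : 0 ≤ p.valueAt φ x := by
  rw [SheafMetric.valueAt]
  split_ifs <;> simp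

lemma SheafMetric.logNorm_eq_log_valueAt {F : SheafOfModules.{w} (holSheaf V S)}
    (p : SheafMetric F) {s : S} (φ : LocalSection F s) (x : S) :
    p.logNorm φ x = Real.log (p.valueAt φ.sec x) := by
  rw [SheafMetric.logNorm, SheafMetric.valueAt]
  split_ifs <;> simp

lemma SheafMetric.continuousAt_valueAt {F : SheafOfModules.{w} (holSheaf V S)} (p : SheafMetric F)
    {U : Opens S} (φ : F.val.obj (op U)) {x : S} (hx : x ∈ U) : ContinuousAt (p.valueAt φ) x := by
  have h1 : ContinuousOn (p.valueAt φ) U := by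
    rw [continuousOn_iff_continuous_domRestrict]
    have : (U : Set S).domRestrict (p.valueAt φ) = fun y : U => (p.toFun U φ y : ℝ) := by
      funext y
      exact p.valueAt_of_mem φ y.2
    rw [this]
    exact NNReal.continuous_coe.comp (p.toFun U φ).continuous
  exact h1.continuousAt (U.isOpen.mem_nhds hx)

variable {F F' : SheafOfModules.{w} (holSheaf V S)} {p : SheafMetric F} {p' : SheafMetric F'}
  {α : F ⟶ F'}

/-- A finite infimum is itself admissible: divide by `p φ` when it is nonzero, and otherwise use any
admissible constant, which exists because the infimum is not `⊤`. -/
lemma le_homNorm_mul {s : S} (hs : homNorm p p' α s ≠ ⊤) (φ : LocalSection F s) :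
    p'.toFun φ.dom (α.val.app (op φ.dom) φ.sec) ⟨s, φ.mem⟩ ≤
      (homNorm p p' α s).toNNReal * p.toFun φ.dom φ.sec ⟨s, φ.mem⟩ := by
  set a' := p'.toFun φ.dom (α.val.app (op φ.dom) φ.sec) ⟨s, φ.mem⟩
  set b := p.toFun φ.dom φ.sec ⟨s, φ.mem⟩ with hb
  by_cases h0 : b = 0
  · have : ∃ a : ℝ≥0, ∀ φ : LocalSection F s,
        p'.toFun φ.dom (α.val.app (op φ.dom) φ.sec) ⟨s, φ.mem⟩ ≤
          a * p.toFun φ.dom φ.sec ⟨s, φ.mem⟩ := by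
      by_contra! hcon
      refine hs ?_
      rw [homNorm, iInf_eq_top]
      intro a
      rw [iInf_eq_top]
      intro ha
      obtain ⟨ψ, hψ⟩ := hcon a
      exact absurd (ha ψ) (not_le.2 hψ)
    obtain ⟨a, ha⟩ := this
    have := ha φ
    rw [← hb, h0, mul_zero] at this
    exact this.trans bot_le
  · have h1 : ((a' / b : ℝ≥0) : ℝ≥0∞) ≤ homNorm p p' α s := by
      refine le_iInf₂ fun a ha => ?_
      rw [ENNReal.coe_le_coe, div_le_iff₀ (pos_iff_ne_zero.2 h0)]
      exact ha φ
    rw [← ENNReal.coe_toNNReal hs, ENNReal.coe_le_coe, div_le_iff₀ (pos_iff_ne_zero.2 h0)] at h1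
    exact h1

lemma homNorm_le {s : S} {a : ℝ≥0} (h : ∀ φ : LocalSection F s,
    p'.toFun φ.dom (α.val.app (op φ.dom) φ.sec) ⟨s, φ.mem⟩ ≤
      a * p.toFun φ.dom φ.sec ⟨s, φ.mem⟩) : homNorm p p' α s ≤ a :=
  iInf₂_le a h

/-- The generalized Levi forms of `log p'(αφ)` are bounded below in terms of those of `log p`, when
the curvature decreases. -/
lemma le_circleLevi_of_griffithsCurvature_le {γ : ℂ → S}
    (φ : LocalSection F (γ 0)) {a : ℝ}
    (hγ : ∀ᶠ ζ in 𝓝 (0 : ℂ), ContMDiffAt 𝓘(ℂ, ℂ) 𝓘(ℂ, V) ∞ γ ζ)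
    (hcurv : ∀ ξ : TangentSpace 𝓘(ℂ, V) (γ 0),
      p'.griffithsCurvature ξ (fiberMap α φ.toFiber) ≤ p.griffithsCurvature ξ φ.toFiber)
    (ha : ∀ ψ : LocalSection F (γ 0), ψ.toFiber = φ.toFiber → ∀ g : ℂ → S,
      (∀ᶠ ζ in 𝓝 (0 : ℂ), ContMDiffAt 𝓘(ℂ, ℂ) 𝓘(ℂ, V) ∞ g ζ) →
      tangentMap 𝓘(ℂ, ℂ) 𝓘(ℂ, V) g ⟨0, (1 : ℂ)⟩ = tangentMap 𝓘(ℂ, ℂ) 𝓘(ℂ, V) γ ⟨0, (1 : ℂ)⟩ →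
      (a : EReal) ≤ circleLevi (p.logNorm ψ ∘ g) 0) :
    (a : EReal) ≤ circleLevi (p'.logNorm (φ.map α) ∘ γ) 0 := by
  set ξ : TangentSpace 𝓘(ℂ, V) (γ 0) :=
    (tangentMap 𝓘(ℂ, ℂ) 𝓘(ℂ, V) γ ⟨0, (1 : ℂ)⟩).2 with hξ
  have h1 : (a : EReal) ≤ ⨅ (ψ : LocalSection F (γ 0)) (_ : ψ.toFiber = φ.toFiber),
      leviForm (p.logNorm ψ) ξ :=
    le_iInf₂ fun ψ hψ => le_iInf fun g => le_iInf₂ fun hg hgt => ha ψ hψ g hg hgt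
  -- On the target side `αφ` and `γ` are just one competitor for the infimum, whereas on the source
  -- side all germs and all curves have to be controlled.
  have h2 : (⨅ (ψ : LocalSection F' (γ 0)) (_ : ψ.toFiber = fiberMap α φ.toFiber),
      leviForm (p'.logNorm ψ) ξ) ≤ circleLevi (p'.logNorm (φ.map α) ∘ γ) 0 :=
    iInf_le_of_le (φ.map α) (iInf_le_of_le rfl
      (iInf_le_of_le γ (iInf_le_of_le hγ (iInf_le_of_le rfl le_rfl))))
  refine le_trans ?_ h2
  have h3 := EReal.neg_le_neg_iff.1 (hcurv ξ)
  set I := ⨅ (ψ : LocalSection F (γ 0)) (_ : ψ.toFiber = φ.toFiber), leviForm (p.logNorm ψ) ξ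
  set I' := ⨅ (ψ : LocalSection F' (γ 0)) (_ : ψ.toFiber = fiberMap α φ.toFiber),
      leviForm (p'.logNorm ψ) ξ
  have h4 : ((2 * a : ℝ) : EReal) ≤ 2 * I' := by
    refine le_trans ?_ h3
    rw [EReal.coe_mul]
    exact mul_le_mul_of_nonneg_left h1 (by norm_num)
  -- The factor `2` is cancelled in `EReal` by cases.
  generalize I' = J at h4
  induction J with
  | bot =>
    rw [EReal.mul_bot_of_pos (by norm_num)] at h4
    exact absurd h4 (not_le.2 (EReal.bot_lt_coe _))
  | coe x =>
    have h5 : ((2 * a : ℝ) : EReal) ≤ ((2 * x : ℝ) : EReal) := by rwa [EReal.coe_mul 2 x]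
    rw [EReal.coe_le_coe_iff] at h5 ⊢
    linarith
  | top => exact le_top

end HomNorm

/-! ### Classes in the fibre and values of sections. -/

section HilbertBundleHom

variable {V : Type*} [NormedAddCommGroup V] [NormedSpace ℂ V]
    {S : Type u} [TopologicalSpace S] [ChartedSpace V S]
    {W : Type*} [NormedAddCommGroup W] [InnerProductSpace ℂ W] [CompleteSpace W]
    {E : S → Type v} [TopologicalSpace (TotalSpace W E)] [∀ s, AddCommGroup (E s)]
    [∀ s, Module ℂ (E s)] [∀ s, TopologicalSpace (E s)]
    [FiberBundle W E] [VectorBundle ℂ W E]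

lemma HermitianMetric.sectionEval_eq_of_toFiber_eq (h : HermitianMetric V W E) {s : S}
    {φ ψ : LocalSection (sectionSheaf V W E) s} (hφ : φ.toFiber = ψ.toFiber) :
    sectionEval φ.sec ⟨s, φ.mem⟩ = sectionEval ψ.sec ⟨s, ψ.mem⟩ := by
  obtain ⟨U, hs, h₁, h₂, hmem⟩ := Quotient.exact hφ
  have h0 := h.sheafMetric.apply_eq_zero_of_mem hs hmem
  exact sub_eq_zero.1 ((h.norm_eq_zero_iff _).1 h0)

/-- The difference of the two sections has `p`-norm zero at `s`, and finiteness of `‖α‖` forces the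
same for its image. There is thus no need to know that a section vanishing at `s` belongs to `𝒥(s)
F`. -/
lemma HermitianMetric.apply_hom_le_of_sectionEval_eq (h : HermitianMetric V W E)
    {F' : SheafOfModules.{max u v} (holSheaf V S)} {p' : SheafMetric F'}
    {α : sectionSheaf V W E ⟶ F'} {s : S} (hs : homNorm h.sheafMetric p' α s ≠ ⊤)
    {φ ψ : LocalSection (sectionSheaf V W E) s}
    (hφ : sectionEval φ.sec ⟨s, φ.mem⟩ = sectionEval ψ.sec ⟨s, ψ.mem⟩) :
    p'.toFun φ.dom (α.val.app (op φ.dom) φ.sec) ⟨s, φ.mem⟩ ≤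
      p'.toFun ψ.dom (α.val.app (op ψ.dom) ψ.sec) ⟨s, ψ.mem⟩ := by
  have hO : s ∈ φ.dom ⊓ ψ.dom := ⟨φ.mem, ψ.mem⟩
  set φ' := restrictSection (sectionSheaf V W E) (inf_le_left : φ.dom ⊓ ψ.dom ≤ φ.dom) φ.sec
  set ψ' := restrictSection (sectionSheaf V W E) (inf_le_right : φ.dom ⊓ ψ.dom ≤ ψ.dom) ψ.sec
  have h1 := le_homNorm_mul hs ⟨φ.dom ⊓ ψ.dom, hO, φ' - ψ'⟩
  have h2 : h.sheafMetric.toFun (φ.dom ⊓ ψ.dom) (φ' - ψ') ⟨s, hO⟩ = 0 :=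
    (h.norm_eq_zero_iff _).2 (sub_eq_zero.2 hφ)
  simp only at h1
  rw [h2, mul_zero, map_sub] at h1
  have h3 := p'.add_le (φ.dom ⊓ ψ.dom) (α.val.app (op (φ.dom ⊓ ψ.dom)) φ' -
    α.val.app (op (φ.dom ⊓ ψ.dom)) ψ') (α.val.app (op (φ.dom ⊓ ψ.dom)) ψ') ⟨s, hO⟩
  rw [sub_add_cancel, le_antisymm h1 bot_le, zero_add, hom_restrictSection, hom_restrictSection,
    p'.restrict, p'.restrict] at h3
  exact h3

end HilbertBundleHom

/-! ### From almost flat sections to plurisubharmonicity of `log ‖α‖`. -/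

section Main

open Filter Metric

variable {V : Type*} [NormedAddCommGroup V] [NormedSpace ℂ V] [CompleteSpace V]
    {S : Type u} [TopologicalSpace S] [ChartedSpace V S] [IsManifold 𝓘(ℂ, V) ∞ S]
    {W : Type*} [NormedAddCommGroup W] [InnerProductSpace ℂ W] [CompleteSpace W]
    {E : S → Type v} [TopologicalSpace (TotalSpace W E)] [∀ s, AddCommGroup (E s)]
    [∀ s, Module ℂ (E s)] [∀ s, TopologicalSpace (E s)]
    [FiberBundle W E] [VectorBundle ℂ W E] [ContMDiffVectorBundle ∞ W E 𝓘(ℂ, V)]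

/-- Near the centre of small discs in a holomorphic curve, `‖α‖` satisfies the sub-mean value
inequality up to an error that is of second order in the radius. -/
lemma HermitianMetric.eventually_homNorm_le_exp (h : HermitianMetric V W E)
    {F' : SheafOfModules.{max u v} (holSheaf V S)} {p' : SheafMetric F'}
    {α : sectionSheaf V W E ⟶ F'} (hα : ∀ s, homNorm h.sheafMetric p' α s ≠ ⊤)
    (hcurv : ∀ (s : S) (ξ : TangentSpace 𝓘(ℂ, V) s) (v : SheafFiber (sectionSheaf V W E) s),
      p'.fiberNorm (fiberMap α v) ≠ 0 →
        p'.griffithsCurvature ξ (fiberMap α v) ≤ h.sheafMetric.griffithsCurvature ξ v)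
    {f : ℂ → S} {z₀ : ℂ} (hf : ∀ᶠ z in 𝓝 z₀, ContMDiffAt 𝓘(ℂ, ℂ) 𝓘(ℂ, V) ∞ f z)
    {ε : ℝ} (hε : 0 < ε) :
    ∀ᶠ r in 𝓝[>] (0 : ℝ), ∀ p : ℂ → ℂ, Differentiable ℂ p →
      (∀ z ∈ sphere z₀ r, ((homNorm h.sheafMetric p' α (f z)).toNNReal : ℝ) ≤
        Real.exp (p z).re) →
      ((homNorm h.sheafMetric p' α (f z₀)).toNNReal : ℝ) ≤
        Real.exp ((p z₀).re + ε * r ^ 2) := by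
  obtain ⟨U, hU, φ, hφ, hflat⟩ := h.exists_almost_flat_sections hf
  obtain ⟨δ, hδ, hball⟩ := Metric.eventually_nhds_iff_ball.1 ((hflat ε hε).and hf)
  have hr0 : ∀ᶠ r : ℝ in 𝓝[>] 0, 0 < r := eventually_mem_nhdsWithin
  filter_upwards [hr0, nhdsWithin_le_nhds (ball_mem_nhds (0 : ℝ) hδ)] with r hr hrδ p hp hb
  rw [mem_ball_zero_iff, Real.norm_eq_abs, abs_of_pos hr] at hrδ
  set N : S → ℝ := fun s => ((homNorm h.sheafMetric p' α s).toNNReal : ℝ) with hN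
  -- The radius was chosen before `w`, so these bounds can be combined into one for the supremum.
  -- Each quotient `A / B` is at most `N`, and so inherits the majorant `exp (Re p)` on the circle.
  have main : ∀ w : W, w ≠ 0 →
      (p'.toFun U (α.val.app (op U) (φ w)) ⟨f z₀, hU⟩ : ℝ) ≤
        Real.exp ((p z₀).re + ε * r ^ 2) * h.sheafMetric.toFun U (φ w) ⟨f z₀, hU⟩ := by
    intro w hw
    set A : S → ℝ := p'.valueAt (α.val.app (op U) (φ w)) with hA
    set B : S → ℝ := h.sheafMetric.valueAt (φ w) with hB
    have hmem : ∀ z ∈ ball z₀ δ, f z ∈ U ∧ B (f z) ≠ 0 := by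
      intro z hz
      obtain ⟨h1, h2, -⟩ := (hball z hz).1 w hw _ rfl
      simp only [add_zero] at h1 h2
      refine ⟨h1, ?_⟩
      rw [hB, h.sheafMetric.valueAt_of_mem _ h1]
      exact_mod_cast h2
    have hfc : ∀ z ∈ ball z₀ δ, ContinuousAt f z := fun z hz => (hball z hz).2.continuousAt
    have hAc : ∀ z ∈ ball z₀ δ, ContinuousAt (fun ζ => A (f ζ)) z := fun z hz =>
      ContinuousAt.comp (g := A) (p'.continuousAt_valueAt _ (hmem z hz).1) (hfc z hz)
    have hBc : ∀ z ∈ ball z₀ δ, ContinuousAt (fun ζ => B (f ζ)) z := fun z hz =>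
      ContinuousAt.comp (g := B) (h.sheafMetric.continuousAt_valueAt _ (hmem z hz).1) (hfc z hz)
    have hsub : closedBall z₀ r ⊆ ball z₀ δ := closedBall_subset_ball hrδ
    have hB0 : ∀ s, 0 ≤ B s := h.sheafMetric.valueAt_nonneg _
    have hle : ∀ z ∈ ball z₀ δ, A (f z) / B (f z) ≤ N (f z) := by
      intro z hz
      obtain ⟨h1, h2⟩ := hmem z hz
      rw [div_le_iff₀ (lt_of_le_of_ne (hB0 _) h2.symm)]
      have h3 := le_homNorm_mul (hα (f z)) ⟨U, h1, φ w⟩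
      rw [hA, hB, p'.valueAt_of_mem _ h1, h.sheafMetric.valueAt_of_mem _ h1]
      exact_mod_cast h3
    have hexp := le_exp_of_le_circleLevi (N := fun z => A (f z) / B (f z)) (c := ε) hr
      (fun z hz => ((hAc z (hsub hz)).div (hBc z (hsub hz))
        (hmem z (hsub hz)).2).continuousWithinAt)
      (fun z _ => div_nonneg (p'.valueAt_nonneg _ _) (hB0 _)) ?_ hp
      (fun z hz => (hle z (hsub (sphere_subset_closedBall hz))).trans (hb z hz))
    · have hz₀ : z₀ ∈ ball z₀ δ := mem_ball_self hδ
      have h2 := (hmem z₀ hz₀).2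
      rw [div_le_iff₀ (lt_of_le_of_ne (hB0 _) h2.symm), hA, hB, p'.valueAt_of_mem _ hU,
        h.sheafMetric.valueAt_of_mem _ hU] at hexp
      exact hexp
    · intro z hz hne
      have hzδ : z ∈ ball z₀ δ := hsub (ball_subset_closedBall hz)
      -- The maximum principle asks for a Levi bound only where the quotient is nonzero, which is
      -- exactly where the curvature hypothesis is available.
      have hAne : A (f z) ≠ 0 := fun h0 => hne (by simp [h0])
      rw [← circleLevi_comp_add]
      set γ : ℂ → S := fun ζ => f (z + ζ) with hγ
      have hγ0 : γ 0 = f z := by simp [hγ]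
      obtain ⟨hzU, -, D, l, hlev, hcmp⟩ := (hball z hzδ).1 w hw γ hγ
      have hnear : ∀ᶠ ζ in 𝓝 (0 : ℂ), z + ζ ∈ ball z₀ δ := by
        have hc : ContinuousAt (fun ζ : ℂ => z + ζ) 0 := by fun_prop
        exact hc.eventually (isOpen_ball.mem_nhds (by simpa using hzδ))
      have hγs : ∀ᶠ ζ in 𝓝 (0 : ℂ), ContMDiffAt 𝓘(ℂ, ℂ) 𝓘(ℂ, V) ∞ γ ζ :=
        eventually_contMDiffAt_comp_add
          (Filter.eventually_of_mem (isOpen_ball.mem_nhds hzδ) fun ζ hζ => (hball ζ hζ).2)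
      have hAγ : ∀ᶠ ζ in 𝓝 (0 : ℂ), ContinuousAt (fun ζ => A (γ ζ)) ζ := by
        filter_upwards [hnear] with ζ hζ
        exact ContinuousAt.comp (g := fun ζ => A (f ζ)) (hAc _ hζ) (by fun_prop)
      have hAγne : ∀ᶠ ζ in 𝓝 (0 : ℂ), A (γ ζ) ≠ 0 :=
        hAγ.self_of_nhds.eventually_ne (by rwa [hγ0])
      have hp'ne : p'.fiberNorm (fiberMap α
          (⟨U, hzU, φ w⟩ : LocalSection (sectionSheaf V W E) (γ 0)).toFiber) ≠ 0 := by
        intro h0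
        refine hAne ?_
        rw [← hγ0, hA, p'.valueAt_of_mem _ hzU]
        exact_mod_cast h0
      have hcL := le_circleLevi_of_griffithsCurvature_le
        (⟨U, hzU, φ w⟩ : LocalSection (sectionSheaf V W E) (γ 0)) (p := h.sheafMetric) (p' := p')
        (α := α) (a := l - ε) hγs (fun ξ => hcurv _ ξ _ hp'ne)
        (fun ψ hψ => hcmp ψ (h.sectionEval_eq_of_toFiber_eq hψ))
      have hAlog : (p'.logNorm (LocalSection.map α
          (⟨U, hzU, φ w⟩ : LocalSection (sectionSheaf V W E) (γ 0))) ∘ γ) =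
          fun ζ => Real.log (A (γ ζ)) := by
        funext ζ
        exact p'.logNorm_eq_log_valueAt _ _
      rw [hAlog] at hcL
      have hsubL := hlev.le_circleLevi_sub (by
        filter_upwards [hAγ, hAγne] with ζ h1 h2
        exact h1.log h2) hcL
      -- The Levi form `l` of `log p(φ)` cancels; only the defect from almost flatness remains.
      have hl : l - ε - l = -ε := by ring
      rw [hl] at hsubL
      refine hsubL.trans (le_of_eq (circleLevi_congr ?_))
      filter_upwards [hnear, hAγne] with ζ h1 h2
      rw [Real.log_div h2 (hmem _ h1).2, h.sheafMetric.logNorm_eq_log_valueAt]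
  -- At the centre every germ `ψ` can be replaced by the almost flat section with the same value; a
  -- germ with value zero is mapped to one with `p'` equal to zero there.
  have hle : homNorm h.sheafMetric p' α (f z₀) ≤
      (Real.toNNReal (Real.exp ((p z₀).re + ε * r ^ 2)) : ℝ≥0∞) := by
    refine homNorm_le fun ψ => ?_
    set v := sectionEval ψ.sec ⟨f z₀, ψ.mem⟩ with hv
    obtain ⟨w, hw, hw0⟩ := hφ v
    by_cases hv0 : v = 0
    · have h1 := le_homNorm_mul (hα (f z₀)) ψ
      have h2 : h.sheafMetric.toFun ψ.dom ψ.sec ⟨f z₀, ψ.mem⟩ = 0 := (h.norm_eq_zero_iff _).2 hv0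
      rw [h2, mul_zero] at h1
      exact h1.trans bot_le
    · have h1 := h.apply_hom_le_of_sectionEval_eq (hα (f z₀)) (φ := ψ) (ψ := ⟨U, hU, φ w⟩)
        (hv.symm.trans hw.symm)
      have h2 : h.sheafMetric.toFun ψ.dom ψ.sec ⟨f z₀, ψ.mem⟩ =
          h.sheafMetric.toFun U (φ w) ⟨f z₀, hU⟩ := congrArg h.norm (hv.symm.trans hw.symm)
      rw [h2]
      refine h1.trans ?_
      rw [← NNReal.coe_le_coe, NNReal.coe_mul, Real.coe_toNNReal _ (Real.exp_pos _).le]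
      exact main w (hw0 hv0)
  have h3 := ENNReal.toNNReal_mono ENNReal.coe_ne_top hle
  rw [ENNReal.toNNReal_coe, ← NNReal.coe_le_coe, Real.coe_toNNReal _ (Real.exp_pos _).le] at h3
  exact h3

end Main

end

theorem theorem2p4
    {V : Type*} [NormedAddCommGroup V] [NormedSpace ℂ V] [FiniteDimensional ℂ V]
    {S : Type u} [TopologicalSpace S] [ChartedSpace V S] [IsManifold 𝓘(ℂ, V) ∞ S]
    {W : Type*} [NormedAddCommGroup W] [InnerProductSpace ℂ W] [CompleteSpace W]
    {E : S → Type v} [TopologicalSpace (TotalSpace W E)] [∀ s, AddCommGroup (E s)]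
    [∀ s, Module ℂ (E s)] [∀ s, TopologicalSpace (E s)]
    [FiberBundle W E] [VectorBundle ℂ W E] [ContMDiffVectorBundle ∞ W E 𝓘(ℂ, V)]
    (h : HermitianMetric V W E)
    (F' : SheafOfModules.{max u v} (holSheaf V S)) (p' : SheafMetric F')
    (α : sectionSheaf V W E ⟶ F') (hα : IsMetricHom h.sheafMetric p' α)
    (hcurv : ∀ (s : S) (ξ : TangentSpace 𝓘(ℂ, V) s) (v : SheafFiber (sectionSheaf V W E) s),
      p'.fiberNorm (fiberMap α v) ≠ 0 →
        p'.griffithsCurvature ξ (fiberMap α v) ≤ h.sheafMetric.griffithsCurvature ξ v) :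
    IsPlurisubharmonic V (fun s => ENNReal.log (homNorm h.sheafMetric p' α s)) := by
  have : CompleteSpace V := FiniteDimensional.complete ℂ V
  have hlog : Continuous fun s => ENNReal.log (homNorm h.sheafMetric p' α s) :=
    ENNReal.continuous_log.comp hα.continuous
  have htop : ∀ s, ENNReal.log (homNorm h.sheafMetric p' α s) ≠ ⊤ := fun s => by
    simpa using hα.ne_top s
  refine ⟨hlog.upperSemicontinuous, htop, fun D f hD hf => ?_⟩
  refine ⟨(hlog.comp_continuousOn hf.continuousOn).upperSemicontinuousOn, fun z _ => htop _,
    fun z r hr hsub => ?_⟩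
  set N : S → ℝ≥0 := fun s => (homNorm h.sheafMetric p' α s).toNNReal with hN
  have hNc : Continuous N := ENNReal.continuousOn_toNNReal.comp_continuous hα.continuous hα.ne_top
  have hfD : ∀ z ∈ D, ∀ᶠ ζ in 𝓝 z, ContMDiffAt 𝓘(ℂ, ℂ) 𝓘(ℂ, V) ∞ f ζ := fun z hz =>
    Filter.eventually_of_mem (hD.mem_nhds hz) fun ζ hζ => hf.contMDiffAt (hD.mem_nhds hζ)
  have hNf : ∀ z ∈ D, ContinuousAt (fun ζ => N (f ζ)) z := fun z hz =>
    hNc.continuousAt.comp (hfD z hz).self_of_nhds.continuousAt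
  have hcoe : ((fun s => ENNReal.log (homNorm h.sheafMetric p' α s)) ∘ f) =
      fun ζ => ENNReal.log (N (f ζ)) := by
    funext ζ
    simp only [hN, Function.comp_apply, ENNReal.coe_toNNReal (hα.ne_top _)]
  rw [hcoe]
  refine log_le_eRealCircleMean (N := fun ζ => N (f ζ)) hr
    (fun ζ hζ => (hNf ζ (hsub (Metric.sphere_subset_closedBall hζ))).continuousWithinAt)
    fun p hp hb => ?_
  -- The local estimates with errors `ε r²` give a nonnegative Levi form at every point where `N ≠
  -- 0`. With `c = 0` there is then no error term, and the disc need not be small.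
  have key := le_exp_of_le_circleLevi (N := fun ζ => (N (f ζ) : ℝ)) (c := 0) hr
    (fun ζ hζ => (NNReal.continuous_coe.continuousAt.comp
      (hNf ζ (hsub hζ))).continuousWithinAt) (fun ζ _ => NNReal.coe_nonneg _) ?_ hp hb
  · simpa using key
  · intro ζ hζ hne
    have hζD : ζ ∈ D := hsub (Metric.ball_subset_closedBall hζ)
    rw [neg_zero, EReal.coe_zero]
    refine circleLevi_nonneg (N := fun ζ => (N (f ζ) : ℝ))
      (lt_of_le_of_ne (NNReal.coe_nonneg _) (Ne.symm hne)) ?_ fun ε hε =>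
      h.eventually_homNorm_le_exp hα.ne_top hcurv (hfD ζ hζD) hε
    filter_upwards [hD.mem_nhds hζD] with η hη
    exact NNReal.continuous_coe.continuousAt.comp (hNf η hη)
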